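/- Let $\Sigma$ be a first-order signature with infinitely many variable symbols and at least one constant symbol, let $I$ be a non-empty set of indices, and let $\mathcal T$ be a finite set of universal axioms (in particular $\mathcal T=\emptyset$ is allowed). Formulae are in negation normal form, i.e. built from positive and negative atomic formulae with $\land,\lor,\forall,\exists$; $\bar A$ is the De Morgan dual, and $A[x:=M]$ is capture-avoiding substitution. Let $A$ be a closed prenex formula over $\Sigma$. Then there is an expansion tree $t$ with $\mathbf{LK}_H\vdash t:A$ (over $\mathcal T$) if and only if $A$ has a Herbrand proof (over $\mathcal T$). Here *expansion trees* are $p ::= S \mid \alpha[a].p \mid (\varepsilon[M_1].p_1+\dots+\varepsilon[M_n].p_n)$, where $S$ is a non-empty finite set of indices, $a$ a variable, each $M_i$ a first-order term, $n\ge 1$, and $+$ is associative and commutative. The calculus $\mathbf{LK}_H$ derives finite multisets of typed expansion trees $t:A$ and cuts $t\bowtie s:A\bowtie\bar A$, by the following rules. - Tautology rule with index $i$: $\{i\}:P_1,\dots,\{i\}:P_n$ is an axiom whenever the $P_j$ are quantifier-free and $\mathcal T\vDash\bigvee_j P_j$. - From $F,\ t:B[x:=a]$ infer $F,\ \alpha[a].t:\forall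 x.B$ (eigenvariable $a$). - From $F,\ t:B[x:=M]$ infer $F,\ (\varepsilon[M].t):\exists x.B$. - From $F,\ t:\exists x.B,\ s:\exists x.B$ infer $F,\ t+s:\exists x.B$. - From $F,\ S:P,\ S':P$ with $P$ quantifier-free infer $F,\ S\cup S':P$. - Cut: from $F,\ t:B$ and $G,\ s:\bar B$ infer $F,\ G,\ t\bowtie s:B\bowtie\bar B$. $\mathbf{LK}_H\vdash F$ means that $F$ has a *strict* proof: distinct tautology rules carry distinct indices, distinct $\forall$-rules have distinct eigenvariables, and no eigenvariable $a$ is free in the type of a non-cut root of a sequent outside the subproof above the rule introducing $\alpha[a]$. A *Herbrand proof* of $A$ over $\mathcal T$ is a triple $(\hat A,A^*,\sigma)$ as follows. - $\hat A$ is an *expansion* of $A$: it is obtained from $A$ by finitely many (possibly zero) replacements of a subformula occurrence $\exists x.B$ by $\exists x.B\lor\exists x.B$. - $A^*$ is a *prenexification* of $\hat A$: bound variables of $\hat A$ are renamed so that distinct quantifier occurrences bind distinct variables, none of them free in the formula, and then a prenex formula $A^*$ is reached by the rewrites $B * qx.C\to qx.(B*C)$ and $qx.B * C\to qx.(B*C)$,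 applied to arbitrary subformulae, with $*\in\{\land,\lor\}$ and $q\in\{\forall,\exists\}$. - $\sigma=(M_1,\dots,M_n)$ is a *witnessing substitution* for $A^*=q_1x_1\dots q_nx_n.B$ ($B$ quantifier-free): $M_i=x_i$ whenever $q_i=\forall$; every variable of $M_j$ lies in $\{x_i : q_i=\forall,\ i<j\}$ whenever $q_j=\exists$; and $\mathcal T\vDash B(M_1,\dots,M_n)$. -/

import Mathlib

noncomputable section

namespace Herbrand

/-! ### Formulae in negation normal form, with named variables

A signature is a first-order language `L` together with an infinite type `V` of variable symbols.
Terms are `L.Term V`. -/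

/-- The two quantifiers. -/
inductive Quantifier
  | all
  | ex

/-- The two binary connectives. -/
inductive Connective
  | and
  | or

/-- The dual quantifier. -/
def Quantifier.dual : Quantifier → Quantifier
  | .all => .ex
  | .ex => .all

/-- The dual connective. -/
def Connective.dual : Connective → Connective
  | .and => .or
  | .or => .and

/-- Formulae of classical first-order logic in negation normal form. The literal `lit true R ts` is
`R(ts)` and `lit false R ts` is the negative atomic formula with the same arguments. -/
inductive Formula (L : FirstOrder.Language.{0, 0}) (V : Type) : Type
  | lit (pos : Bool) {n : ℕ} (R : L.Relations n) (ts : Fin n → L.Term V) : Formula L V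
  | bin (c : Connective) (A B : Formula L V) : Formula L V
  | quant (q : Quantifier) (x : V) (A : Formula L V) : Formula L V

namespace Formula

variable {L : FirstOrder.Language.{0, 0}} {V : Type}

/-- The De Morgan dual. -/
def dual : Formula L V → Formula L V
  | lit pos R ts => lit (!pos) R ts
  | bin c A B => bin c.dual A.dual B.dual
  | quant q x A => quant q.dual x A.dual

/-- Quantifier-free formulae. -/
def IsQF : Formula L V → Prop
  | lit _ _ _ => True
  | bin _ A B => A.IsQF ∧ B.IsQF
  | quant _ _ _ => False

/-- Prenex formulae: a string of quantifiers followed by a quantifier-free formula. -/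
def IsPrenex : Formula L V → Prop
  | quant _ _ A => A.IsPrenex
  | A => A.IsQF

/-- Universal prenex formulae: a string of universal quantifiers followed by a quantifier-free
formula. -/
def IsUniversal : Formula L V → Prop
  | quant .all _ A => A.IsUniversal
  | A => A.IsQF

/-- The quantifier prefix of a prenex formula, outermost quantifier first. -/
def pref : Formula L V → List (Quantifier × V)
  | quant q x A => (q, x) :: A.pref
  | _ => []

/-- The matrix of a prenex formula. -/
def matrix : Formula L V → Formula L V
  | quant _ _ A => A.matrix
  | A => A

/-- The variables bound by the quantifier occurrences of a formula, listed with repetitions. -/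
def binders : Formula L V → List V
  | lit _ _ _ => []
  | bin _ A B => A.binders ++ B.binders
  | quant _ x A => x :: A.binders

variable [DecidableEq V]

/-- The free variables. -/
def free : Formula L V → Finset V
  | lit _ _ ts => Finset.univ.biUnion fun i => (ts i).varFinset
  | bin _ A B => A.free ∪ B.free
  | quant _ x A => A.free.erase x

/-- Closed formulae. -/
def IsClosed (A : Formula L V) : Prop := A.free = ∅

/-- Satisfaction in a structure under an assignment. -/
def Holds {M : Type} [L.Structure M] : Formula L V → (V → M) → Prop
  | lit true R ts, v => FirstOrder.Language.Structure.RelMap R fun i => (ts i).realize v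
  | lit false R ts, v => ¬ FirstOrder.Language.Structure.RelMap R fun i => (ts i).realize v
  | bin .and A B, v => A.Holds v ∧ B.Holds v
  | bin .or A B, v => A.Holds v ∨ B.Holds v
  | quant .all x A, v => ∀ m : M, A.Holds (Function.update v x m)
  | quant .ex x A, v => ∃ m : M, A.Holds (Function.update v x m)

variable [Infinite V]

/-- Some variable outside a finite set. -/
def fresh (S : Finset V) : V := (Infinite.exists_notMem_finset S).choose

/-- Capture-avoiding simultaneous substitution. A bound variable `y` is kept unless it would
capture a variable of a term substituted for a free variable of `q y. A`; in that case it is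
replaced by a fresh variable. -/
def substAll : Formula L V → (V → L.Term V) → Formula L V
  | lit pos R ts, σ => lit pos R fun i => (ts i).subst σ
  | bin c A B, σ => bin c (A.substAll σ) (B.substAll σ)
  | quant q y A, σ =>
    let S : Finset V := (A.free.erase y).biUnion fun v => (σ v).varFinset
    let z : V := if y ∈ S then fresh S else y
    quant q z (A.substAll (Function.update σ y (.var z)))

/-- `A[x := M]`, capture-avoiding. -/
def subst (A : Formula L V) (x : V) (M : L.Term V) : Formula L V :=
  A.substAll (Function.update .var x M)

end Formula

section Semantics

variable {L : FirstOrder.Language.{0, 0}} {V : Type} [DecidableEq V]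

/-- `T ⊨ ⋁ Ps`: in every (non-empty) model of `T`, under every assignment, some member of `Ps`
holds. Free variables of the axioms in `T` are read as universally quantified. -/
def EntailsOr (T : Set (Formula L V)) (Ps : Multiset (Formula L V)) : Prop :=
  ∀ (M : Type) [Nonempty M] [L.Structure M],
    (∀ B ∈ T, ∀ v : V → M, B.Holds v) → ∀ v : V → M, ∃ P ∈ Ps, P.Holds v

/-- `T ⊨ P`. -/
def Entails (T : Set (Formula L V)) (P : Formula L V) : Prop := EntailsOr T {P}

end Semantics

/-! ### Herbrand proofs -/

/-- Formulae with precisely one occurrence of a hole. -/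
inductive Context (L : FirstOrder.Language.{0, 0}) (V : Type) : Type
  | hole : Context L V
  | binL (c : Connective) (C : Context L V) (B : Formula L V) : Context L V
  | binR (c : Connective) (A : Formula L V) (C : Context L V) : Context L V
  | quant (q : Quantifier) (x : V) (C : Context L V) : Context L V

/-- Replacement of the hole by a formula (free variables may become bound). -/
def Context.fill {L : FirstOrder.Language.{0, 0}} {V : Type} : Context L V → Formula L V → Formula L V
  | hole, A => A
  | binL c C B, A => .bin c (C.fill A) B
  | binR c B C, A => .bin c B (C.fill A)
  | quant q x C, A => .quant q x (C.fill A)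

section HerbrandProofs

variable {L : FirstOrder.Language.{0, 0}} {V : Type}

/-- `IsExpansion A B`: the formula `B` is an expansion of `A`. -/
inductive IsExpansion (A : Formula L V) : Formula L V → Prop
  | refl : IsExpansion A A
  | step (C : Context L V) (x : V) (B : Formula L V) :
      IsExpansion A (C.fill (.quant .ex x B)) →
      IsExpansion A (C.fill (.bin .or (.quant .ex x B) (.quant .ex x B)))

/-- One step of pulling a quantifier to the front, inside an arbitrary context. -/
inductive PrenexStep : Formula L V → Formula L V → Prop
  | right (C : Context L V) (c : Connective) (q : Quantifier) (x : V) (A B : Formula L V) :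
      PrenexStep (C.fill (.bin c A (.quant q x B))) (C.fill (.quant q x (.bin c A B)))
  | left (C : Context L V) (c : Connective) (q : Quantifier) (x : V) (A B : Formula L V) :
      PrenexStep (C.fill (.bin c (.quant q x A) B)) (C.fill (.quant q x (.bin c A B)))

variable [DecidableEq V] [Infinite V]

/-- Equality of formulae up to renaming of bound variables. -/
inductive AlphaEq : Formula L V → Formula L V → Prop
  | refl (A : Formula L V) : AlphaEq A A
  | symm {A B : Formula L V} : AlphaEq A B → AlphaEq B A
  | trans {A B C : Formula L V} : AlphaEq A B → AlphaEq B C → AlphaEq A C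
  | bin (c : Connective) {A A' B B' : Formula L V} :
      AlphaEq A A' → AlphaEq B B' → AlphaEq (.bin c A B) (.bin c A' B')
  | quant (q : Quantifier) (x : V) {A A' : Formula L V} :
      AlphaEq A A' → AlphaEq (.quant q x A) (.quant q x A')
  | rename (q : Quantifier) (x y : V) (A : Formula L V) :
      y ∉ (Formula.quant q x A).free →
      AlphaEq (.quant q x A) (.quant q y (A.subst x (.var y)))

/-- `IsPrenexification A B`: after renaming the bound variables of `A` so that distinct quantifier
occurrences bind distinct variables, none of which is free in `A`, the quantifiers are pulled to
the front, with prenex result `B`. -/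
def IsPrenexification (A B : Formula L V) : Prop :=
  ∃ A' : Formula L V, AlphaEq A A' ∧ A'.binders.Nodup ∧ (∀ x ∈ A'.binders, x ∉ A'.free) ∧
    Relation.ReflTransGen PrenexStep A' B ∧ B.IsPrenex

/-- The simultaneous substitution that sends the `i`-th variable of the prefix of `A` to `M i`
(if a variable is quantified repeatedly, the innermost quantifier decides) and fixes all other
variables. -/
def prefixSubst (A : Formula L V) (M : Fin A.pref.length → L.Term V) : V → L.Term V :=
  (List.finRange A.pref.length).foldl (fun σ i => Function.update σ (A.pref.get i).2 (M i))
    .var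

/-- `M` is a witnessing substitution (over `T`) for the closed prenex formula
`A = q₁x₁ … qₙxₙ. B`. -/
structure IsWitnessing (T : Set (Formula L V)) (A : Formula L V)
    (M : Fin A.pref.length → L.Term V) : Prop where
  /-- `Mᵢ = xᵢ` if `qᵢ` is universal. -/
  universal : ∀ i, (A.pref.get i).1 = .all → M i = .var (A.pref.get i).2
  /-- If `qⱼ` is existential, then every variable of `Mⱼ` is a universal `xᵢ` with `i < j`. -/
  existential : ∀ j, (A.pref.get j).1 = .ex → ∀ y ∈ (M j).varFinset,
    ∃ i < j, (A.pref.get i).1 = .all ∧ (A.pref.get i).2 = y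
  /-- `T ⊨ B(M₁, …, Mₙ)`. -/
  valid : Entails T (A.matrix.substAll (prefixSubst A M))

/-- A Herbrand proof of `A` over `T`: an expansion, a prenexification of it, and a witnessing
substitution for the latter. -/
structure HerbrandProof (T : Set (Formula L V)) (A : Formula L V) where
  /-- The expansion. -/
  expansion : Formula L V
  /-- The prenexification. -/
  prenexification : Formula L V
  /-- The witnessing substitution. -/
  witness : Fin prenexification.pref.length → L.Term V
  isExpansion : IsExpansion A expansion
  isPrenexification : IsPrenexification expansion prenexification
  isWitnessing : IsWitnessing T prenexification witness

end HerbrandProofs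

/-! ### Expansion trees

Formal sums of witnessing terms form the free commutative semigroup, so raw terms are taken
modulo associativity and commutativity of `+`. -/

/-- The two sorts of terms: expansion trees, and non-empty formal sums of witnessing terms. -/
inductive TermSort
  | tree
  | sum

/-- Raw terms: `S`, `α[a].p`, `( w + ⋯ + w )` are expansion trees; `ε[M].p` and `w + w'` are formal
sums. -/
inductive RawTerm (L : FirstOrder.Language.{0, 0}) (V I : Type) : TermSort → Type
  | leaf (S : Finset I) (hS : S.Nonempty) : RawTerm L V I .tree
  | alpha (a : V) (p : RawTerm L V I .tree) : RawTerm L V I .tree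
  | expand (w : RawTerm L V I .sum) : RawTerm L V I .tree
  | eps (M : L.Term V) (p : RawTerm L V I .tree) : RawTerm L V I .sum
  | add (w w' : RawTerm L V I .sum) : RawTerm L V I .sum

/-- The relation generating the congruence of associativity and commutativity of `+`. -/
inductive RawTerm.ACStep {L : FirstOrder.Language.{0, 0}} {V I : Type} :
    {s : TermSort} → RawTerm L V I s → RawTerm L V I s → Prop
  | comm (u v) : ACStep (add u v) (add v u)
  | assoc (u v w) : ACStep (add (add u v) w) (add u (add v w))
  | alpha (a) {p p'} : ACStep p p' → ACStep (alpha a p) (alpha a p')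
  | expand {w w'} : ACStep w w' → ACStep (expand w) (expand w')
  | eps (M) {p p'} : ACStep p p' → ACStep (eps M p) (eps M p')
  | addL (v) {u u'} : ACStep u u' → ACStep (add u v) (add u' v)
  | addR (u) {v v'} : ACStep v v' → ACStep (add u v) (add u v')

/-- Terms modulo associativity and commutativity of `+`. -/
def ETerm (L : FirstOrder.Language.{0, 0}) (V I : Type) (s : TermSort) : Type :=
  Quot (RawTerm.ACStep (L := L) (V := V) (I := I) (s := s))

/-- Expansion trees. -/
abbrev ExpTree (L : FirstOrder.Language.{0, 0}) (V I : Type) : Type := ETerm L V I .tree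

/-- Non-empty formal sums of witnessing terms. -/
abbrev WitSum (L : FirstOrder.Language.{0, 0}) (V I : Type) : Type := ETerm L V I .sum

section Terms

variable {L : FirstOrder.Language.{0, 0}} {V I : Type}

/-- The expansion tree `S`, for a non-empty finite set `S` of indices. -/
def ExpTree.leaf (S : Finset I) (hS : S.Nonempty) : ExpTree L V I := Quot.mk _ (.leaf S hS)

/-- The expansion tree `α[a].t`. -/
def ExpTree.alpha (a : V) : ExpTree L V I → ExpTree L V I :=
  Quot.map (RawTerm.alpha a) fun _ _ h => .alpha a h

/-- A formal sum, as an expansion tree. -/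
def ExpTree.expand : WitSum L V I → ExpTree L V I :=
  Quot.map RawTerm.expand fun _ _ h => .expand h

/-- The one-element formal sum `ε[M].t`. -/
def WitSum.eps (M : L.Term V) : ExpTree L V I → WitSum L V I :=
  Quot.map (RawTerm.eps M) fun _ _ h => .eps M h

/-- Addition of formal sums. -/
def WitSum.add : WitSum L V I → WitSum L V I → WitSum L V I :=
  Quot.map₂ RawTerm.add (fun u _ _ h => .addR u h) fun _ _ v h => .addL v h

end Terms

/-! ### The annotated sequent calculus -/

/-- The roots of the forests derived in the calculus: a typed expansion tree `t : A`, or a cut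
`t ⋈ s : A ⋈ Ā`. (Naked witnesses do not occur in derivations.) -/
inductive Root (L : FirstOrder.Language.{0, 0}) (V I : Type) : Type
  | typed (t : ExpTree L V I) (A : Formula L V) : Root L V I
  | cut (t s : ExpTree L V I) (A : Formula L V) : Root L V I

/-- Forests, as finite multisets of roots. -/
abbrev Forest (L : FirstOrder.Language.{0, 0}) (V I : Type) : Type := Multiset (Root L V I)

section Calculus

variable {L : FirstOrder.Language.{0, 0}} {V I : Type} [DecidableEq V]

/-- The variables free in the type of a forest, that is, in the type of one of its non-cut roots. -/
def Forest.typeFree (F : Forest L V I) : Set V :=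
  {x | ∃ t A, Root.typed t A ∈ F ∧ x ∈ A.free}

variable [DecidableEq I] [Infinite V]

/-- Proofs in `LK_H` over the theory `T`: trees of rule instances. -/
inductive LKProof (T : Set (Formula L V)) : Forest L V I → Type
  | taut (i : I) (Ps : Multiset (Formula L V)) (hqf : ∀ P ∈ Ps, P.IsQF) (hT : EntailsOr T Ps) :
      LKProof T (Ps.map fun P => .typed (.leaf {i} (Finset.singleton_nonempty i)) P)
  | allR (F : Forest L V I) (t : ExpTree L V I) (x a : V) (A : Formula L V)
      (Φ : LKProof T (.typed t (A.subst x (.var a)) ::ₘ F)) :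
      LKProof T (.typed (.alpha a t) (.quant .all x A) ::ₘ F)
  | exR (F : Forest L V I) (t : ExpTree L V I) (x : V) (M : L.Term V) (A : Formula L V)
      (Φ : LKProof T (.typed t (A.subst x M) ::ₘ F)) :
      LKProof T (.typed (.expand (.eps M t)) (.quant .ex x A) ::ₘ F)
  | contrEx (F : Forest L V I) (t s : WitSum L V I) (x : V) (A : Formula L V)
      (Φ : LKProof T (.typed (.expand t) (.quant .ex x A) ::ₘ
        .typed (.expand s) (.quant .ex x A) ::ₘ F)) :
      LKProof T (.typed (.expand (t.add s)) (.quant .ex x A) ::ₘ F)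
  | contrQF (F : Forest L V I) (S S' : Finset I) (hS : S.Nonempty) (hS' : S'.Nonempty)
      (P : Formula L V) (hP : P.IsQF)
      (Φ : LKProof T (.typed (.leaf S hS) P ::ₘ .typed (.leaf S' hS') P ::ₘ F)) :
      LKProof T (.typed (.leaf (S ∪ S') (hS.mono Finset.subset_union_left)) P ::ₘ F)
  | cut (F G : Forest L V I) (t s : ExpTree L V I) (A : Formula L V)
      (Φ : LKProof T (.typed t A ::ₘ F)) (Ψ : LKProof T (.typed s A.dual ::ₘ G)) :
      LKProof T (.cut t s A ::ₘ (F + G))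

namespace LKProof

variable {T : Set (Formula L V)}

/-- The sequent proved by a proof. -/
def conclusion {F : Forest L V I} (_ : LKProof T F) : Forest L V I := F

/-- The indices of the tautology rules of a proof, with multiplicity. -/
def indices : {F : Forest L V I} → LKProof T F → Multiset I
  | _, taut i _ _ _ => {i}
  | _, allR _ _ _ _ _ Φ => Φ.indices
  | _, exR _ _ _ _ _ Φ => Φ.indices
  | _, contrEx _ _ _ _ _ Φ => Φ.indices
  | _, contrQF _ _ _ _ _ _ _ Φ => Φ.indices
  | _, cut _ _ _ _ _ Φ Ψ => Φ.indices + Ψ.indices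

/-- The eigenvariables of the universal rules of a proof, with multiplicity. -/
def eigenvars : {F : Forest L V I} → LKProof T F → Multiset V
  | _, taut _ _ _ _ => 0
  | _, allR _ _ _ a _ Φ => a ::ₘ Φ.eigenvars
  | _, exR _ _ _ _ _ Φ => Φ.eigenvars
  | _, contrEx _ _ _ _ _ Φ => Φ.eigenvars
  | _, contrQF _ _ _ _ _ _ _ Φ => Φ.eigenvars
  | _, cut _ _ _ _ _ Φ Ψ => Φ.eigenvars + Ψ.eigenvars

/-- The sequents of a proof that do not lie in the subproof above a rule introducing `α[a]`. -/
def outside (a : V) : {F : Forest L V I} → LKProof T F → Set (Forest L V I)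
  | _, taut i Ps hqf hT => {(taut i Ps hqf hT).conclusion}
  | _, allR F t x b A Φ => {(allR F t x b A Φ).conclusion} ∪ if b = a then ∅ else Φ.outside a
  | _, exR F t x M A Φ => {(exR F t x M A Φ).conclusion} ∪ Φ.outside a
  | _, contrEx F t s x A Φ => {(contrEx F t s x A Φ).conclusion} ∪ Φ.outside a
  | _, contrQF F S S' hS hS' P hP Φ =>
    {(contrQF F S S' hS hS' P hP Φ).conclusion} ∪ Φ.outside a
  | _, cut F G t s A Φ Ψ => {(cut F G t s A Φ Ψ).conclusion} ∪ (Φ.outside a ∪ Ψ.outside a)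

/-- Strict proofs. -/
structure IsStrict {F : Forest L V I} (Φ : LKProof T F) : Prop where
  /-- Distinct tautology rules carry distinct indices. -/
  indices_nodup : Φ.indices.Nodup
  /-- Distinct universal rules have distinct eigenvariables. -/
  eigenvars_nodup : Φ.eigenvars.Nodup
  /-- An eigenvariable is not free in the type of any sequent outside the subproof above its
  rule. -/
  eigenvars_local : ∀ a ∈ Φ.eigenvars, ∀ G ∈ Φ.outside a, a ∉ Forest.typeFree G

end LKProof

/-- `LK_H ⊢ F` over `T`: there is a strict proof of `F`. -/
def LKProvable (T : Set (Formula L V)) (F : Forest L V I) : Prop :=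
  ∃ Φ : LKProof T F, Φ.IsStrict

end Calculus

end Herbrand

end

/-! Each of the two notions of proof is equivalent to validity of `A` in all models of `T`, and the
equivalence is obtained through validity: no expansion tree is translated into a Herbrand proof or
back, and no cut is eliminated. Soundness is `LKProvable.valid` and `HerbrandProof.valid`.

The converse is Herbrand's theorem, `Valid.exists_derivable`, proved by compactness. Over the
universe `Obj L`, form the tree of instantiations of the prefix of `A`: an existential node has a
child for every object, a universal node `u` only one, for the generic object `eig u`. Under a
valuation of the atoms that satisfies `T`, truth of `A` descends along some branch to a true
quantifier-free leaf. As the axioms are universal, these valuations form a compact set, while truth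
of a leaf is a clopen condition; so finitely many leaves already contain a true one under each such
valuation. Reading the relevant `eig u` as variables turns objects into terms, and introducing the
nodes in a suitable order gives a cut-free, non-branching derivation in the sense of `Derivable`.

Such a derivation keeps each formula in its original form, together with a name and a value for each
variable. The values yield the sequent proof (`Derivable.provableAvoiding`). The names become the
bound variables of the renamed expansion (`Derivable.hasCopies`), and the order of the quantifier
inferences from the root upwards becomes the order of the prenex prefix. -/

namespace Herbrand

noncomputable section

open FirstOrder.Language

/-! ### Substitution and evaluation of terms. -/

section TermLemmas

variable {L : FirstOrder.Language.{0, 0}} {V W : Type}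

theorem realize_congr_varFinset [DecidableEq V] {M : Type} [L.Structure M] (t : L.Term V)
    {v w : V → M} (h : ∀ x ∈ t.varFinset, v x = w x) : t.realize v = t.realize w := by
  induction t with
  | var x => exact h x (by simp)
  | func f ts ih =>
    simp only [Term.realize]
    congr 1
    funext i
    exact ih i fun x hx => h x (by simpa using ⟨i, hx⟩)

theorem varFinset_subst [DecidableEq V] [DecidableEq W] (t : L.Term V) (σ : V → L.Term W) :
    (t.subst σ).varFinset = t.varFinset.biUnion fun x => (σ x).varFinset := by
  induction t with
  | var x => simp [Term.subst]
  | func f ts ih =>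
    simp only [Term.subst, Term.varFinset, ih, Finset.biUnion_biUnion]

theorem subst_congr_varFinset [DecidableEq V] (t : L.Term V) {σ τ : V → L.Term W}
    (h : ∀ x ∈ t.varFinset, σ x = τ x) : t.subst σ = t.subst τ := by
  induction t with
  | var x => exact h x (by simp)
  | func f ts ih =>
    simp only [Term.subst]
    congr 1
    funext i
    exact ih i fun x hx => h x (by simpa using ⟨i, hx⟩)

theorem subst_var_id (t : L.Term V) : t.subst Term.var = t := by
  induction t with
  | var x => rfl
  | func f ts ih =>
    simp only [Term.subst]
    congr 1
    funext i
    exact ih i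

theorem subst_subst {X : Type} (t : L.Term V) (σ : V → L.Term W) (τ : W → L.Term X) :
    (t.subst σ).subst τ = t.subst fun x => (σ x).subst τ := by
  induction t with
  | var x => rfl
  | func f ts ih =>
    simp only [Term.subst]
    congr 1
    funext i
    exact ih i

end TermLemmas

/-! ### Semantics and capture-avoiding substitution. -/

namespace Formula

theorem fresh_notMem {V : Type} [Infinite V] (S : Finset V) : fresh S ∉ S :=
  (Infinite.exists_notMem_finset S).choose_spec

variable {L : FirstOrder.Language.{0, 0}} {V : Type} [DecidableEq V]

section Semantics

variable {M : Type} [L.Structure M]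

theorem holds_congr (A : Formula L V) {v w : V → M} (h : ∀ x ∈ A.free, v x = w x) :
    A.Holds v ↔ A.Holds w := by
  induction A generalizing v w with
  | lit pos R ts =>
    have : (fun i => (ts i).realize v) = fun i => (ts i).realize w := by
      funext i
      exact realize_congr_varFinset _ fun x hx => h x (by simpa [free] using ⟨i, hx⟩)
    cases pos <;> simp [Holds, this]
  | bin c A B ihA ihB =>
    have h1 := ihA fun x hx => h x (by simp [free, hx])
    have h2 := ihB fun x hx => h x (by simp [free, hx])
    cases c <;> simp [Holds, h1, h2]
  | quant q y A ih =>
    have key : ∀ m : M, A.Holds (Function.update v y m) ↔ A.Holds (Function.update w y m) := by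
      intro m
      refine ih fun x hx => ?_
      by_cases hxy : x = y
      · subst hxy; simp
      · simpa [hxy] using h x (by simp [free, hx, hxy])
    cases q <;> simp [Holds, key]

/-- Truth of a formula after its leading quantifiers have been instantiated by the given
elements. -/
def HoldsAlong : Formula L V → (V → M) → List M → Prop
  | quant _ x A, v, m :: ms => A.HoldsAlong (Function.update v x m) ms
  | A, v, _ => A.Holds v

theorem holdsAlong_nil (A : Formula L V) (v : V → M) : A.HoldsAlong v [] ↔ A.Holds v := by
  cases A <;> simp [HoldsAlong]

theorem holdsAlong_congr (A : Formula L V) {v w : V → M} (ms : List M)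
    (h : ∀ x ∈ A.free, v x = w x) : A.HoldsAlong v ms ↔ A.HoldsAlong w ms := by
  induction A generalizing v w ms with
  | lit pos R ts => exact holds_congr _ h
  | bin c A B => exact holds_congr _ h
  | quant q y A ih =>
    cases ms with
    | nil => exact holds_congr _ h
    | cons m ms =>
      refine ih ms fun x hx => ?_
      by_cases hxy : x = y
      · subst hxy; simp
      · simpa [hxy] using h x (by simp [free, hx, hxy])

theorem realize_update_var (x : V) (N : L.Term V) (v : V → M) :
    (fun y => (Function.update (Term.var : V → L.Term V) x N y).realize v) =
      Function.update v x (N.realize v) := by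
  funext y
  by_cases h : y = x
  · subst h; simp
  · simp [h]

end Semantics

variable [Infinite V]

/-- The variable that replaces `y` when a substitution is applied to `q y. A`. -/
def bound (A : Formula L V) (y : V) (σ : V → L.Term V) : V :=
  let S : Finset V := (A.free.erase y).biUnion fun v => (σ v).varFinset
  if y ∈ S then fresh S else y

theorem substAll_quant (q : Quantifier) (y : V) (A : Formula L V) (σ : V → L.Term V) :
    (quant q y A).substAll σ =
      quant q (A.bound y σ) (A.substAll (Function.update σ y (.var (A.bound y σ)))) := rfl

theorem bound_notMem (A : Formula L V) (y : V) (σ : V → L.Term V) :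
    A.bound y σ ∉ (A.free.erase y).biUnion fun v => (σ v).varFinset := by
  unfold bound
  simp only
  split_ifs with h
  · exact fresh_notMem _
  · exact h

theorem bound_notMem_varFinset (A : Formula L V) (y : V) (σ : V → L.Term V) {x : V}
    (hx : x ∈ A.free) (hxy : x ≠ y) : A.bound y σ ∉ (σ x).varFinset := by
  intro h
  exact A.bound_notMem y σ (Finset.mem_biUnion.2 ⟨x, Finset.mem_erase.2 ⟨hxy, hx⟩, h⟩)

theorem free_substAll (A : Formula L V) (σ : V → L.Term V) :
    (A.substAll σ).free = A.free.biUnion fun v => (σ v).varFinset := by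
  induction A generalizing σ with
  | lit pos R ts => simp only [substAll, free, varFinset_subst, Finset.biUnion_biUnion]
  | bin c A B ihA ihB => simp only [substAll, free, ihA, ihB, Finset.union_biUnion]
  | quant q y A ih =>
    rw [substAll_quant, free, ih, free]
    have hz := A.bound_notMem y σ
    set z := A.bound y σ
    ext x
    simp only [Finset.mem_erase, Finset.mem_biUnion]
    constructor
    · rintro ⟨hxz, u, hu, hx⟩
      by_cases huy : u = y
      · subst huy; simp [hxz] at hx
      · exact ⟨u, ⟨huy, hu⟩, by simpa [huy] using hx⟩
    · rintro ⟨u, ⟨huy, hu⟩, hx⟩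
      refine ⟨?_, u, hu, by simpa [huy] using hx⟩
      rintro rfl
      exact A.bound_notMem_varFinset y σ hu huy hx

theorem substAll_congr (A : Formula L V) {σ τ : V → L.Term V} (h : ∀ x ∈ A.free, σ x = τ x) :
    A.substAll σ = A.substAll τ := by
  induction A generalizing σ τ with
  | lit pos R ts =>
    simp only [substAll]
    congr 1
    funext i
    exact subst_congr_varFinset _ fun x hx => h x (by simpa [free] using ⟨i, hx⟩)
  | bin c A B ihA ihB =>
    simp only [substAll]
    rw [ihA fun x hx => h x (by simp [free, hx]), ihB fun x hx => h x (by simp [free, hx])]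
  | quant q y A ih =>
    have hb : A.bound y σ = A.bound y τ := by
      have : ((A.free.erase y).biUnion fun v => (σ v).varFinset) =
          (A.free.erase y).biUnion fun v => (τ v).varFinset :=
        Finset.biUnion_congr rfl fun x hx => by rw [h x hx]
      simp only [bound, this]
    rw [substAll_quant, substAll_quant, hb]
    congr 1
    refine ih fun x hx => ?_
    by_cases hxy : x = y
    · subst hxy; simp
    · simpa [hxy] using h x (by simp [free, hx, hxy])

theorem substAll_var (A : Formula L V) : A.substAll .var = A := by
  induction A with
  | lit pos R ts => simp only [substAll, subst_var_id]
  | bin c A B ihA ihB => simp only [substAll, ihA, ihB]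
  | quant q y A ih =>
    have hb : A.bound y .var = y := by simp [bound]
    rw [substAll_quant, hb, Function.update_eq_self_iff.2 rfl, ih]

theorem holds_substAll {M : Type} [L.Structure M] (A : Formula L V) (σ : V → L.Term V)
    (v : V → M) : (A.substAll σ).Holds v ↔ A.Holds fun x => (σ x).realize v := by
  induction A generalizing σ v with
  | lit pos R ts => cases pos <;> simp [substAll, Holds, Term.realize_subst]
  | bin c A B ihA ihB => cases c <;> simp [substAll, Holds, ihA, ihB]
  | quant q y A ih =>
    have key : ∀ m : M, (A.substAll (Function.update σ y (.var (A.bound y σ)))).Holds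
        (Function.update v (A.bound y σ) m) ↔
        A.Holds (Function.update (fun x => (σ x).realize v) y m) := by
      intro m
      rw [ih]
      refine holds_congr _ fun x hx => ?_
      by_cases hxy : x = y
      · subst hxy; simp
      · simp only [Function.update_of_ne hxy]
        refine realize_congr_varFinset _ fun u hu => ?_
        rw [Function.update_of_ne]
        rintro rfl
        exact A.bound_notMem_varFinset y σ hx hxy hu
    rw [substAll_quant]
    cases q <;> simp [Holds, key]

theorem holdsAlong_substAll {M : Type} [L.Structure M] (A : Formula L V) (σ : V → L.Term V)
    (v : V → M) (ms : List M) :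
    (A.substAll σ).HoldsAlong v ms ↔ A.HoldsAlong (fun x => (σ x).realize v) ms := by
  induction A generalizing σ v ms with
  | lit pos R ts => exact holds_substAll _ _ _
  | bin c A B => exact holds_substAll _ _ _
  | quant q y A ih =>
    cases ms with
    | nil => simp only [holdsAlong_nil]; exact holds_substAll _ _ _
    | cons m ms =>
      rw [substAll_quant]
      simp only [HoldsAlong]
      rw [ih]
      refine holdsAlong_congr _ _ fun x hx => ?_
      by_cases hxy : x = y
      · subst hxy; simp
      · simp only [Function.update_of_ne hxy]
        refine realize_congr_varFinset _ fun u hu => ?_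
        rw [Function.update_of_ne]
        rintro rfl
        exact A.bound_notMem_varFinset y σ hx hxy hu

theorem holds_subst {M : Type} [L.Structure M] (A : Formula L V) (x : V) (N : L.Term V)
    (v : V → M) : (A.subst x N).Holds v ↔ A.Holds (Function.update v x (N.realize v)) := by
  rw [subst, holds_substAll, realize_update_var]

theorem holdsAlong_subst {M : Type} [L.Structure M] (A : Formula L V) (x : V) (N : L.Term V)
    (v : V → M) (ms : List M) :
    (A.subst x N).HoldsAlong v ms ↔ A.HoldsAlong (Function.update v x (N.realize v)) ms := by
  rw [subst, holdsAlong_substAll, realize_update_var]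

theorem free_subst_subset (A : Formula L V) (x : V) (N : L.Term V) :
    (A.subst x N).free ⊆ A.free.erase x ∪ N.varFinset := by
  intro y hy
  rw [subst, free_substAll, Finset.mem_biUnion] at hy
  obtain ⟨u, hu, hy⟩ := hy
  by_cases h : u = x
  · subst h
    simp at hy
    simp [hy]
  · simp [h] at hy
    subst hy
    simp [h, hu]

theorem isQF_substAll {A : Formula L V} (σ : V → L.Term V) : (A.substAll σ).IsQF ↔ A.IsQF := by
  induction A with
  | lit => exact Iff.rfl
  | bin c A B ihA ihB => simp [substAll, IsQF, ihA, ihB]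
  | quant => simp [substAll, IsQF]

theorem isPrenex_substAll {A : Formula L V} (σ : V → L.Term V) :
    (A.substAll σ).IsPrenex ↔ A.IsPrenex := by
  induction A generalizing σ with
  | lit => exact Iff.rfl
  | bin c A B ihA ihB =>
    simpa [substAll, IsPrenex] using isQF_substAll (A := bin c A B) σ
  | quant q x A ih => simpa [substAll_quant, IsPrenex] using ih _

end Formula

/-! ### Renaming of bound variables. -/

section Alpha

variable {L : FirstOrder.Language.{0, 0}} {V : Type} [DecidableEq V] [Infinite V]

open Formula

theorem AlphaEq.of_eq {A B : Formula L V} (h : A = B) : AlphaEq A B := h ▸ .refl A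

/-- Substitutions compose up to renaming of bound variables. -/
theorem alphaEq_substAll_substAll (A : Formula L V) (σ τ : V → L.Term V) :
    AlphaEq ((A.substAll σ).substAll τ) (A.substAll fun x => (σ x).subst τ) := by
  induction A generalizing σ τ with
  | lit pos R ts => exact .of_eq (by simp only [substAll, subst_subst])
  | bin c A B ihA ihB => exact .bin c (ihA σ τ) (ihB σ τ)
  | quant q y A ih =>
    rw [substAll_quant, substAll_quant, substAll_quant]
    set z₁ := A.bound y σ with hz₁
    set z₂ := (A.substAll (Function.update σ y (.var z₁))).bound z₁ τ with hz₂
    set ρ : V → L.Term V := fun x => (σ x).subst τ with hρ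
    set z₃ := A.bound y ρ with hz₃
    have h₁ : ∀ x ∈ A.free, x ≠ y → z₁ ∉ (σ x).varFinset :=
      fun x hx hxy => A.bound_notMem_varFinset y σ hx hxy
    -- If `z₂` occurred in `(σ x).subst τ`, it would occur in `τ u` for a variable `u ≠ z₁` that is
    -- free in the inner result, which the choice of `z₂` excludes.
    have h₂ : ∀ x ∈ A.free, x ≠ y → z₂ ∉ (ρ x).varFinset := by
      intro x hx hxy hz
      rw [hρ, varFinset_subst, Finset.mem_biUnion] at hz
      obtain ⟨u, hu, hz⟩ := hz
      refine bound_notMem_varFinset _ z₁ τ (x := u) ?_ ?_ (hz₂ ▸ hz)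
      · rw [free_substAll, Finset.mem_biUnion]
        exact ⟨x, hx, by simpa [hxy] using hu⟩
      · rintro rfl
        exact h₁ x hx hxy hu
    have h₃ : ∀ x ∈ A.free, x ≠ y → z₃ ∉ (ρ x).varFinset :=
      fun x hx hxy => A.bound_notMem_varFinset y ρ hx hxy
    have e₁ : AlphaEq ((A.substAll (Function.update σ y (.var z₁))).substAll
        (Function.update τ z₁ (.var z₂))) (A.substAll (Function.update ρ y (.var z₂))) := by
      refine (ih _ _).trans (.of_eq (substAll_congr _ fun x hx => ?_))
      by_cases hxy : x = y
      · subst hxy; simp [Term.subst]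
      · simp only [Function.update_of_ne hxy, hρ]
        refine subst_congr_varFinset _ fun u hu => ?_
        rw [Function.update_of_ne]
        rintro rfl
        exact h₁ x hx hxy hu
    have e₂ : AlphaEq ((A.substAll (Function.update ρ y (.var z₂))).subst z₂ (.var z₃))
        (A.substAll (Function.update ρ y (.var z₃))) := by
      refine (ih _ _).trans (.of_eq (substAll_congr _ fun x hx => ?_))
      by_cases hxy : x = y
      · subst hxy; simp [Term.subst]
      · simp only [Function.update_of_ne hxy]
        conv_rhs => rw [← subst_var_id (ρ x)]
        refine subst_congr_varFinset _ fun u hu => ?_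
        rw [Function.update_of_ne]
        rintro rfl
        exact h₂ x hx hxy hu
    refine (AlphaEq.quant q z₂ e₁).trans ((AlphaEq.rename q z₂ z₃ _ ?_).trans (.quant q z₃ e₂))
    rw [free, free_substAll, Finset.mem_erase, Finset.mem_biUnion]
    rintro ⟨hne, x, hx, hz⟩
    by_cases hxy : x = y
    · subst hxy; simp at hz; exact hne hz
    · simp [hxy] at hz; exact h₃ x hx hxy hz

end Alpha

/-- `A` holds in every model of `T` under every assignment. -/
def Valid {L : FirstOrder.Language.{0, 0}} {V : Type} [DecidableEq V] (T : Set (Formula L V))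
    (A : Formula L V) : Prop :=
  ∀ (M : Type) [Nonempty M] [L.Structure M],
    (∀ B ∈ T, ∀ v : V → M, B.Holds v) → ∀ v : V → M, A.Holds v

/-! ### Soundness of the sequent calculus. -/

section CalculusSoundness

variable {L : FirstOrder.Language.{0, 0}} {V I : Type} [DecidableEq V]

theorem Formula.holds_dual {M : Type} [L.Structure M] (A : Formula L V) (v : V → M) :
    A.dual.Holds v ↔ ¬ A.Holds v := by
  induction A generalizing v with
  | lit pos R ts => cases pos <;> simp [dual, Holds]
  | bin c A B ihA ihB => cases c <;> simp [dual, Connective.dual, Holds, ihA, ihB, imp_iff_not_or]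
  | quant q x A ih => cases q <;> simp [dual, Quantifier.dual, Holds, ih]

variable [DecidableEq I] [Infinite V] {T : Set (Formula L V)}

/-- Cut roots carry no meaning here: a sequent is read as the disjunction of the types of its other
roots. A cut is sound because a formula and its dual never hold together, a universal rule because
strictness keeps its eigenvariable out of the conclusion. -/
theorem LKProof.holds_of_isStrict {F : Forest L V I} (Φ : LKProof T F) (hΦ : Φ.IsStrict)
    {M : Type} [Nonempty M] [L.Structure M] (hM : ∀ B ∈ T, ∀ v : V → M, B.Holds v) (v : V → M) :
    ∃ t A, Root.typed t A ∈ F ∧ A.Holds v := by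
  induction Φ generalizing v with
  | taut i Ps hqf hT =>
    obtain ⟨P, hP, h⟩ := hT M hM v
    exact ⟨_, P, Multiset.mem_map_of_mem _ hP, h⟩
  | allR F t x a A Φ ih =>
    have hnd : a ∉ Φ.eigenvars ∧ Φ.eigenvars.Nodup := Multiset.nodup_cons.1 hΦ.eigenvars_nodup
    have hloc := hΦ.eigenvars_local
    -- Eigenvariables above this rule differ from `a`, so for them `outside` does not stop here and
    -- locality descends to the premise.
    have hs : Φ.IsStrict := by
      refine ⟨hΦ.indices_nodup, hnd.2, fun b hb G hG => ?_⟩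
      have hab : a ≠ b := fun h => hnd.1 (h ▸ hb)
      refine hloc b (Multiset.mem_cons_of_mem hb) G (Or.inr ?_)
      simpa [hab] using hG
    have ha := hloc a (Multiset.mem_cons_self _ _) _ (Or.inl rfl)
    simp only [LKProof.conclusion, Forest.typeFree, Set.mem_ofPred_eq, not_exists, not_and] at ha
    -- If the conclusion fails at `v`, then for every `m` the premise, with `a` set to `m`, can only
    -- be true through the instance of `A`; this makes the universal formula true after all.
    by_contra hcon
    push Not at hcon
    have hall := hcon _ _ (Multiset.mem_cons_self _ _)
    refine hall fun m => ?_
    obtain ⟨s, B, hB, hv⟩ := ih hs (Function.update v a m)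
    rcases Multiset.mem_cons.1 hB with h | h
    · obtain ⟨-, rfl⟩ := Root.typed.inj h
      rw [Formula.holds_subst] at hv
      refine (Formula.holds_congr _ fun y hy => ?_).1 hv
      by_cases hyx : y = x
      · subst hyx; simp
      · have hya : y ≠ a := by
          rintro rfl
          exact ha _ _ (Multiset.mem_cons_self _ _) (by simp [Formula.free, hyx, hy])
        simp [hyx, hya]
    · refine (hcon s B (Multiset.mem_cons_of_mem h) ?_).elim
      refine (Formula.holds_congr _ fun y hy => ?_).1 hv
      rw [Function.update_of_ne]
      rintro rfl
      exact ha _ _ (Multiset.mem_cons_of_mem h) hy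
  | exR F t x N A Φ ih =>
    have hs : Φ.IsStrict := ⟨hΦ.indices_nodup, hΦ.eigenvars_nodup,
      fun b hb G hG => hΦ.eigenvars_local b hb G (Or.inr hG)⟩
    obtain ⟨s, B, hB, hv⟩ := ih hs v
    rcases Multiset.mem_cons.1 hB with h | h
    · obtain ⟨-, rfl⟩ := Root.typed.inj h
      rw [Formula.holds_subst] at hv
      exact ⟨_, _, Multiset.mem_cons_self _ _, _, hv⟩
    · exact ⟨s, B, Multiset.mem_cons_of_mem h, hv⟩
  | contrEx F t s x A Φ ih =>
    have hs : Φ.IsStrict := ⟨hΦ.indices_nodup, hΦ.eigenvars_nodup,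
      fun b hb G hG => hΦ.eigenvars_local b hb G (Or.inr hG)⟩
    obtain ⟨s, B, hB, hv⟩ := ih hs v
    rcases Multiset.mem_cons.1 hB with h | h
    · obtain ⟨-, rfl⟩ := Root.typed.inj h
      exact ⟨_, _, Multiset.mem_cons_self _ _, hv⟩
    · rcases Multiset.mem_cons.1 h with h | h
      · obtain ⟨-, rfl⟩ := Root.typed.inj h
        exact ⟨_, _, Multiset.mem_cons_self _ _, hv⟩
      · exact ⟨s, B, Multiset.mem_cons_of_mem h, hv⟩
  | contrQF F S S' hS hS' P hP Φ ih =>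
    have hs : Φ.IsStrict := ⟨hΦ.indices_nodup, hΦ.eigenvars_nodup,
      fun b hb G hG => hΦ.eigenvars_local b hb G (Or.inr hG)⟩
    obtain ⟨s, B, hB, hv⟩ := ih hs v
    rcases Multiset.mem_cons.1 hB with h | h
    · obtain ⟨-, rfl⟩ := Root.typed.inj h
      exact ⟨_, _, Multiset.mem_cons_self _ _, hv⟩
    · rcases Multiset.mem_cons.1 h with h | h
      · obtain ⟨-, rfl⟩ := Root.typed.inj h
        exact ⟨_, _, Multiset.mem_cons_self _ _, hv⟩
      · exact ⟨s, B, Multiset.mem_cons_of_mem h, hv⟩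
  | cut F G t s A Φ Ψ ihΦ ihΨ =>
    have hi := Multiset.nodup_add.1 hΦ.indices_nodup
    have he := Multiset.nodup_add.1 hΦ.eigenvars_nodup
    have h₁ : Φ.IsStrict := ⟨hi.1, he.1, fun b hb G hG =>
      hΦ.eigenvars_local b (Multiset.mem_add.2 (Or.inl hb)) G (Or.inr (Or.inl hG))⟩
    have h₂ : Ψ.IsStrict := ⟨hi.2.1, he.2.1, fun b hb G hG =>
      hΦ.eigenvars_local b (Multiset.mem_add.2 (Or.inr hb)) G (Or.inr (Or.inr hG))⟩
    obtain ⟨t', B, hB, hv⟩ := ihΦ h₁ v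
    obtain ⟨s', C, hC, hw⟩ := ihΨ h₂ v
    rcases Multiset.mem_cons.1 hB with h | h
    · rcases Multiset.mem_cons.1 hC with h' | h'
      · obtain ⟨-, rfl⟩ := Root.typed.inj h
        obtain ⟨-, rfl⟩ := Root.typed.inj h'
        exact (((Formula.holds_dual _ v).1 hw) hv).elim
      · exact ⟨s', C, Multiset.mem_cons_of_mem (Multiset.mem_add.2 (Or.inr h')), hw⟩
    · exact ⟨t', B, Multiset.mem_cons_of_mem (Multiset.mem_add.2 (Or.inl h)), hv⟩

theorem LKProvable.valid {t : ExpTree L V I} {A : Formula L V}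
    (h : LKProvable T {Root.typed t A}) : Valid T A := by
  intro M _ _ hM v
  obtain ⟨Φ, hΦ⟩ := h
  obtain ⟨s, B, hB, hv⟩ := Φ.holds_of_isStrict hΦ hM v
  obtain ⟨-, rfl⟩ := Root.typed.inj (Multiset.mem_singleton.1 hB)
  exact hv

end CalculusSoundness

/-! ### Soundness of Herbrand proofs. -/

section HerbrandSoundness

variable {L : FirstOrder.Language.{0, 0}} {V : Type}

theorem Formula.binders_eq_map_pref {A : Formula L V} (hA : A.IsPrenex) :
    A.binders = A.pref.map Prod.snd := by
  have qf : ∀ A : Formula L V, A.IsQF → A.binders = [] := by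
    intro A hA
    induction A with
    | lit => rfl
    | bin c A B ihA ihB => simp [binders, ihA hA.1, ihB hA.2]
    | quant => exact hA.elim
  induction A with
  | lit => rfl
  | bin c A B => exact qf _ hA
  | quant q x A ih => simp [binders, pref, ih hA]

theorem Formula.IsPrenex.isQF {A : Formula L V} (hA : A.IsPrenex) (h : A.pref = []) : A.IsQF := by
  cases A with
  | lit => exact hA
  | bin => exact hA
  | quant => simp [pref] at h

theorem Formula.IsQF.pref_eq_nil {A : Formula L V} (hA : A.IsQF) : A.pref = [] := by
  cases A with
  | lit => rfl
  | bin => rfl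
  | quant => exact hA.elim

theorem Formula.IsQF.isPrenex {A : Formula L V} (hA : A.IsQF) : A.IsPrenex := by
  cases A with
  | lit => exact hA
  | bin => exact hA
  | quant => exact hA.elim

theorem Context.binders_perm (C : Context L V) {A B : Formula L V}
    (h : A.binders.Perm B.binders) : (C.fill A).binders.Perm (C.fill B).binders := by
  induction C with
  | hole => exact h
  | binL c C D ih => exact ih.append_right _
  | binR c D C ih => exact ih.append_left _
  | quant q x C ih => exact ih.cons x

theorem Context.mem_binders (C : Context L V) {A : Formula L V} {x : V} (h : x ∈ A.binders) :
    x ∈ (C.fill A).binders := by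
  induction C with
  | hole => exact h
  | binL c C D ih => exact List.mem_append_left _ ih
  | binR c D C ih => exact List.mem_append_right _ ih
  | quant q x C ih => exact List.mem_cons_of_mem _ ih

/-- `ws` is a list of witnesses for the quantifier prefix `p`, whose terms for existential
quantifiers may use the variables in `U` and the preceding universal variables. -/
def WitnessList [DecidableEq V] : Finset V → List (Quantifier × V) → List (L.Term V) → Prop
  | _, [], [] => True
  | U, (.all, a) :: p, w :: ws => w = .var a ∧ WitnessList (insert a U) p ws
  | U, (.ex, _) :: p, w :: ws => w.varFinset ⊆ U ∧ WitnessList U p ws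
  | _, _, _ => False

/-- The substitution obtained from `τ` by successively updating it along a prefix. -/
def extend [DecidableEq V] : (V → L.Term V) → List (Quantifier × V) → List (L.Term V) → V → L.Term V
  | τ, qx :: p, w :: ws => extend (Function.update τ qx.2 w) p ws
  | τ, _, _ => τ

variable [DecidableEq V]

theorem WitnessList.length_eq {U : Finset V} {p : List (Quantifier × V)} {ws : List (L.Term V)}
    (h : WitnessList U p ws) : ws.length = p.length := by
  induction p generalizing U ws with
  | nil => cases ws <;> simp_all [WitnessList]
  | cons qx p ih =>
    obtain ⟨q, x⟩ := qx
    cases ws with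
    | nil => cases q <;> exact h.elim
    | cons w ws => cases q <;> simp [ih h.2]

/-- Passes from the fold over positions in `prefixSubst` to a recursion along the prefix, on which
induction is possible. -/
theorem foldl_update_eq_extend (τ : V → L.Term V) (p : List (Quantifier × V))
    (M : Fin p.length → L.Term V) :
    (List.finRange p.length).foldl (fun σ i => Function.update σ (p.get i).2 (M i)) τ =
      extend τ p (List.ofFn M) := by
  induction p generalizing τ with
  | nil => rfl
  | cons qx p ih =>
    have h := ih (Function.update τ qx.2 (M 0)) fun i => M i.succ
    simp only [List.length_cons, List.finRange_succ, List.foldl_cons, List.foldl_map,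
      List.ofFn_succ, extend]
    exact h

/-- The set `U` is needed for the induction: it holds the universal variables already passed. For `U
= ∅` the right-hand side is the pair of variable conditions of `IsWitnessing`. -/
theorem witnessList_iff (U : Finset V) (p : List (Quantifier × V))
    (M : Fin p.length → L.Term V) :
    WitnessList U p (List.ofFn M) ↔
      (∀ i, (p.get i).1 = .all → M i = .var (p.get i).2) ∧
      ∀ j, (p.get j).1 = .ex → ∀ y ∈ (M j).varFinset,
        y ∈ U ∨ ∃ i < j, (p.get i).1 = .all ∧ (p.get i).2 = y := by
  induction p generalizing U with
  | nil => simp [WitnessList]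
  | cons qx p ih =>
    obtain ⟨q, x⟩ := qx
    have h := fun U => ih U fun i => M i.succ
    have e : (List.ofFn M : List (L.Term V)) = M 0 :: List.ofFn fun i => M i.succ :=
      List.ofFn_succ
    rw [e]
    cases q with
    | all =>
      simp only [WitnessList, h, List.length_cons, Fin.forall_fin_succ, Fin.exists_fin_succ]
      simp only [List.get_cons_zero, List.get_cons_succ', Fin.succ_lt_succ_iff, Fin.succ_pos,
        Fin.not_lt_zero, Finset.mem_insert]
      constructor
      · rintro ⟨h0, h1, h2⟩
        refine ⟨⟨fun _ => h0, h1⟩, by simp, fun j hj y hy => ?_⟩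
        rcases h2 j hj y hy with (rfl | h) | h
        · simp
        · exact Or.inl h
        · exact Or.inr (Or.inr h)
      · rintro ⟨⟨h0, h1⟩, -, h2⟩
        refine ⟨h0 trivial, h1, fun j hj y hy => ?_⟩
        rcases h2 j hj y hy with h | ⟨-, -, h⟩ | h
        · exact Or.inl (Or.inr h)
        · exact Or.inl (Or.inl h.symm)
        · exact Or.inr h
    | ex =>
      simp only [WitnessList, h, List.length_cons, Fin.forall_fin_succ, Fin.exists_fin_succ]
      simp only [List.get_cons_zero, List.get_cons_succ', Fin.succ_lt_succ_iff, Fin.succ_pos,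
        Fin.not_lt_zero]
      constructor
      · rintro ⟨h0, h1, h2⟩
        refine ⟨⟨by simp, h1⟩, fun _ y hy => Or.inl (h0 hy), fun j hj y hy => ?_⟩
        rcases h2 j hj y hy with h | h
        · exact Or.inl h
        · exact Or.inr (Or.inr h)
      · rintro ⟨⟨-, h1⟩, h0, h2⟩
        refine ⟨fun y hy => ?_, h1, fun j hj y hy => ?_⟩
        · simpa using h0 trivial y hy
        · rcases h2 j hj y hy with h | ⟨-, h, -⟩ | h
          · exact Or.inl h
          · cases h
          · exact Or.inr h

/-- In `h`, the assignment `w` is arbitrary on the variables still to be quantified. Hence a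
universal variable may take any value, whereas an existential term, whose variables lie in `U` and
so off the prefix, has the same value under all these `w`; that value is the witness. -/
theorem holds_of_witnessList {M : Type} [L.Structure M] (A : Formula L V) (hA : A.IsPrenex)
    (U : Finset V) (ws : List (L.Term V)) (hws : WitnessList U A.pref ws)
    (hnd : (A.pref.map Prod.snd).Nodup) (hU : ∀ x ∈ A.pref.map Prod.snd, x ∉ U)
    (τ : V → L.Term V) (v : V → M)
    (h : ∀ w : V → M, (∀ x, x ∉ A.pref.map Prod.snd → w x = v x) →
      (∀ x ∈ A.free, (τ x).realize w = v x) ∧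
        A.matrix.Holds fun x => (extend τ A.pref ws x).realize w) :
    A.Holds v := by
  have qf : ∀ (A : Formula L V) (ws : List (L.Term V)) (τ : V → L.Term V) (v : V → M),
      A.matrix = A → A.pref = [] →
      (∀ w : V → M, (∀ x, x ∉ A.pref.map Prod.snd → w x = v x) →
      (∀ x ∈ A.free, (τ x).realize w = v x) ∧
        A.matrix.Holds fun x => (extend τ A.pref ws x).realize w) → A.Holds v := by
    intro A ws τ v e₁ e₂ h
    obtain ⟨h1, h2⟩ := h v fun _ _ => rfl
    rw [e₁] at h2
    refine (Formula.holds_congr _ fun x hx => ?_).1 h2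
    rw [← h1 x hx, e₂]
    simp [extend]
  induction A generalizing U ws τ v with
  | lit => exact qf _ ws τ v rfl rfl h
  | bin => exact qf _ ws τ v rfl rfl h
  | quant q x A ih =>
    simp only [Formula.pref, List.map_cons, List.nodup_cons, List.mem_cons, not_or,
      forall_eq_or_imp] at hws hnd hU h
    cases ws with
    | nil => cases q <;> exact hws.elim
    | cons N ws =>
      have step : ∀ (U' : Finset V) (m : M), WitnessList U' A.pref ws →
          (∀ y ∈ A.pref.map Prod.snd, y ∉ U') →
          (∀ w : V → M, (∀ y, y ∉ A.pref.map Prod.snd → w y = Function.update v x m y) →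
            N.realize w = m) → A.Holds (Function.update v x m) := by
        intro U' m hws' hU' hN
        refine ih hA U' ws hws' hnd.2 hU' (Function.update τ x N) _ fun w hw => ?_
        obtain ⟨h1, h2⟩ := h w fun y hy => by rw [hw y hy.2, Function.update_of_ne hy.1]
        refine ⟨fun y hy => ?_, h2⟩
        by_cases hyx : y = x
        · subst hyx; simpa using hN w hw
        · simpa [hyx] using h1 y (by simp [Formula.free, hyx, hy])
      cases q with
      | all =>
        intro m
        refine step (insert x U) m hws.2 (fun y hy hyU => ?_) fun w hw => ?_
        · rcases Finset.mem_insert.1 hyU with rfl | hyU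
          · exact hnd.1 hy
          · exact hU.2 y hy hyU
        · rw [hws.1]
          simpa using hw x hnd.1
      | ex =>
        refine ⟨N.realize v, step U _ hws.2 hU.2 fun w hw => ?_⟩
        refine realize_congr_varFinset _ fun y hy => ?_
        have hyU := hws.1 hy
        rw [hw y fun h => hU.2 y h hyU, Function.update_of_ne]
        rintro rfl
        exact hU.1 hyU

theorem Context.holds_congr {M : Type} [L.Structure M] (C : Context L V) {A B : Formula L V}
    (h : ∀ v : V → M, A.Holds v ↔ B.Holds v) (v : V → M) :
    (C.fill A).Holds v ↔ (C.fill B).Holds v := by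
  induction C generalizing v with
  | hole => exact h v
  | binL c C D ih => cases c <;> simp [fill, Formula.Holds, ih]
  | binR c D C ih => cases c <;> simp [fill, Formula.Holds, ih]
  | quant q x C ih => cases q <;> simp [fill, Formula.Holds, ih]

theorem Context.free_congr (C : Context L V) {A B : Formula L V} (h : A.free = B.free) :
    (C.fill A).free = (C.fill B).free := by
  induction C with
  | hole => exact h
  | binL c C D ih => simp [fill, Formula.free, ih]
  | binR c D C ih => simp [fill, Formula.free, ih]
  | quant q x C ih => simp [fill, Formula.free, ih]

/-- A quantifier around the hole cannot bind `x`, since `x` is already bound inside the hole and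
binders are distinct. -/
theorem Context.mem_free (C : Context L V) {A : Formula L V} {x : V}
    (hnd : (C.fill A).binders.Nodup) (hb : x ∈ A.binders) (hf : x ∈ A.free) :
    x ∈ (C.fill A).free := by
  induction C with
  | hole => exact hf
  | binL c C D ih => exact Finset.mem_union_left _ (ih (List.nodup_append.1 hnd).1)
  | binR c D C ih => exact Finset.mem_union_right _ (ih (List.nodup_append.1 hnd).2.1)
  | quant q y C ih =>
    have hnd := List.nodup_cons.1 hnd
    refine Finset.mem_erase.2 ⟨?_, ih hnd.2⟩
    rintro rfl
    exact hnd.1 (C.mem_binders hb)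

/-- Distinct quantifier occurrences bind distinct variables, none of which is free. -/
def Rectified (A : Formula L V) : Prop :=
  A.binders.Nodup ∧ ∀ x ∈ A.binders, x ∉ A.free

theorem Rectified.fill {A B : Formula L V} {C : Context L V} (h : Rectified (C.fill A))
    (hb : A.binders.Perm B.binders) (hf : A.free = B.free) : Rectified (C.fill B) := by
  refine ⟨(C.binders_perm hb).nodup_iff.1 h.1, fun x hx => ?_⟩
  rw [← C.free_congr hf]
  exact h.2 x ((C.binders_perm hb).mem_iff.2 hx)

/-- The rewrite rules carry no side condition; rectification supplies it. If the shifted variable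
were free in the other operand, `Context.mem_free` would make it free in the whole formula. Nonempty
domains are needed to shift a quantifier over an operand without its variable. -/
theorem PrenexStep.rectified {A B : Formula L V} (h : PrenexStep A B) (hA : Rectified A) :
    Rectified B ∧ ∀ {M : Type} [L.Structure M] [Nonempty M] (v : V → M), A.Holds v ↔ B.Holds v := by
  cases h with
  | right C c q x A B =>
    have hx : x ∉ A.free := fun hx =>
      hA.2 x (C.mem_binders (by simp [Formula.binders]))
        (C.mem_free hA.1 (by simp [Formula.binders]) (by simp [Formula.free, hx]))
    refine ⟨hA.fill ?_ ?_, fun v => C.holds_congr (fun v => ?_) v⟩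
    · simp [Formula.binders]
    · simp [Formula.free, Finset.erase_union_distrib, Finset.erase_eq_of_notMem hx]
    · have key : ∀ m, A.Holds (Function.update v x m) ↔ A.Holds v := fun m =>
        Formula.holds_congr _ fun y hy => Function.update_of_ne (by rintro rfl; exact hx hy) _ _
      cases c <;> cases q <;>
        simp [Formula.Holds, key, forall_and, forall_or_left, exists_or]
  | left C c q x A B =>
    have hx : x ∉ B.free := fun hx =>
      hA.2 x (C.mem_binders (by simp [Formula.binders]))
        (C.mem_free hA.1 (by simp [Formula.binders]) (by simp [Formula.free, hx]))
    refine ⟨hA.fill ?_ ?_, fun v => C.holds_congr (fun v => ?_) v⟩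
    · simp [Formula.binders]
    · simp [Formula.free, Finset.erase_union_distrib, Finset.erase_eq_of_notMem hx]
    · have key : ∀ m, B.Holds (Function.update v x m) ↔ B.Holds v := fun m =>
        Formula.holds_congr _ fun y hy => Function.update_of_ne (by rintro rfl; exact hx hy) _ _
      cases c <;> cases q <;>
        simp [Formula.Holds, key, forall_and, forall_or_right, exists_or]

theorem rectified_of_prenexSteps {A B : Formula L V} (h : Relation.ReflTransGen PrenexStep A B)
    (hA : Rectified A) :
    Rectified B ∧ ∀ {M : Type} [L.Structure M] [Nonempty M] (v : V → M), A.Holds v ↔ B.Holds v := by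
  induction h with
  | refl => exact ⟨hA, fun _ => Iff.rfl⟩
  | tail _ hs ih =>
    have h := hs.rectified ih.1
    exact ⟨h.1, fun v => (ih.2 v).trans (h.2 v)⟩

theorem IsExpansion.holds_iff {A B : Formula L V} (h : IsExpansion A B) {M : Type}
    [L.Structure M] (v : V → M) : A.Holds v ↔ B.Holds v := by
  induction h with
  | refl => exact Iff.rfl
  | step C x B _ ih =>
    exact ih.trans (C.holds_congr (fun v => by simp [Formula.Holds]) v)

variable [Infinite V]

theorem AlphaEq.holds_iff {A B : Formula L V} (h : AlphaEq A B) {M : Type} [L.Structure M]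
    (v : V → M) : A.Holds v ↔ B.Holds v := by
  induction h generalizing v with
  | refl => exact Iff.rfl
  | symm _ ih => exact (ih v).symm
  | trans _ _ ih₁ ih₂ => exact (ih₁ v).trans (ih₂ v)
  | bin c _ _ ih₁ ih₂ => cases c <;> simp [Formula.Holds, ih₁, ih₂]
  | quant q x _ ih => cases q <;> simp [Formula.Holds, ih]
  | rename q x y A hy =>
    have key : ∀ m, A.Holds (Function.update v x m) ↔
        (A.subst x (.var y)).Holds (Function.update v y m) := by
      intro m
      rw [Formula.holds_subst]
      refine Formula.holds_congr _ fun z hz => ?_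
      by_cases hzx : z = x
      · subst hzx; simp
      · have hzy : z ≠ y := by
          rintro rfl
          exact hy (by simp [Formula.free, hzx, hz])
        simp [hzx, hzy]
    cases q <;> simp [Formula.Holds, key]

theorem HerbrandProof.valid {T : Set (Formula L V)} {A : Formula L V} (h : HerbrandProof T A) :
    Valid T A := by
  intro M _ _ hM v
  obtain ⟨A', hα, hnd, hfr, hsteps, hpre⟩ := h.isPrenexification
  obtain ⟨hrect, hiff⟩ := rectified_of_prenexSteps hsteps ⟨hnd, hfr⟩
  rw [h.isExpansion.holds_iff, hα.holds_iff, hiff]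
  have hw := h.isWitnessing
  have hwl := (witnessList_iff ∅ _ h.witness).2 ⟨hw.universal, fun j hj y hy =>
    Or.inr (hw.existential j hj y hy)⟩
  rw [Rectified, Formula.binders_eq_map_pref hpre] at hrect
  refine holds_of_witnessList _ hpre ∅ _ hwl hrect.1 (by simp) .var v fun w hwv => ⟨?_, ?_⟩
  · intro x hx
    simpa using hwv x fun h => hrect.2 x h hx
  · obtain ⟨P, hP, hh⟩ := hw.valid M hM w
    rw [Multiset.mem_singleton.1 hP, Formula.holds_substAll, prefixSubst,
      foldl_update_eq_extend] at hh
    exact hh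

end HerbrandSoundness

/-! ### Linear derivations. -/

/-- A formula together with a renaming and an interpretation of its free variables. -/
structure Instance (L : FirstOrder.Language.{0, 0}) (V : Type) where
  /-- The formula. -/
  formula : Formula L V
  /-- The renaming of the free variables. -/
  name : V → V
  /-- The terms denoted by the free variables. -/
  value : V → L.Term V

section Derivations

variable {L : FirstOrder.Language.{0, 0}} {V : Type} [DecidableEq V]

/-- Truth of an instance. -/
def Instance.Holds {M : Type} [L.Structure M] (g : Instance L V) (v : V → M) : Prop :=
  g.formula.Holds fun x => (g.value x).realize v

/-- Linear derivations of multisets of instances: every quantifier inference introduces a new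
name, and the terms witnessing existential quantifiers contain only names of universal
quantifiers. Here `U` is the set of names of universal quantifiers and `Y` the set of all names
used so far. -/
inductive Derivable (T : Set (Formula L V)) :
    Finset V → Finset V → Multiset (Instance L V) → Prop
  | ax (U Y : Finset V) (Γ : Multiset (Instance L V)) (hqf : ∀ g ∈ Γ, g.formula.IsQF)
      (hT : ∀ (M : Type) [Nonempty M] [L.Structure M],
        (∀ B ∈ T, ∀ v : V → M, B.Holds v) → ∀ v : V → M, ∃ g ∈ Γ, g.Holds v) :
      Derivable T U Y Γ
  | all (U Y : Finset V) (Γ : Multiset (Instance L V)) (x : V) (A : Formula L V) (η : V → V)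
      (σ : V → L.Term V) (a : V) (ha : a ∉ Y)
      (h : Derivable T (insert a U) (insert a Y)
        (⟨A, Function.update η x a, Function.update σ x (.var a)⟩ ::ₘ Γ)) :
      Derivable T U Y (⟨.quant .all x A, η, σ⟩ ::ₘ Γ)
  | ex (U Y : Finset V) (Γ : Multiset (Instance L V)) (x : V) (A : Formula L V) (η : V → V)
      (σ : V → L.Term V) (z : V) (hz : z ∉ Y) (N : L.Term V) (hN : N.varFinset ⊆ U)
      (h : Derivable T U (insert z Y)
        (⟨A, Function.update η x z, Function.update σ x N⟩ ::ₘ Γ)) :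
      Derivable T U Y (⟨.quant .ex x A, η, σ⟩ ::ₘ Γ)
  | contr (U Y : Finset V) (Γ : Multiset (Instance L V)) (x : V) (A : Formula L V) (η : V → V)
      (σ : V → L.Term V)
      (h : Derivable T U Y (⟨.quant .ex x A, η, σ⟩ ::ₘ ⟨.quant .ex x A, η, σ⟩ ::ₘ Γ)) :
      Derivable T U Y (⟨.quant .ex x A, η, σ⟩ ::ₘ Γ)

/-- There is no weakening, so quantified formulae that are no longer useful have to be stripped down
to quantifier-free ones. Fresh names and the witness `c` do this without any condition on `U`. -/
theorem derivable_of_isPrenex [Infinite V] (c : L.Constants) (T : Set (Formula L V))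
    (U Y : Finset V) (Γ : Multiset (Instance L V)) (hpre : ∀ g ∈ Γ, g.formula.IsPrenex)
    (hT : ∀ (M : Type) [Nonempty M] [L.Structure M],
      (∀ B ∈ T, ∀ v : V → M, B.Holds v) →
        ∀ v : V → M, ∃ g ∈ Γ, g.formula.IsQF ∧ g.Holds v) :
    Derivable T U Y Γ := by
  induction hn : (Γ.map fun g => g.formula.pref.length).sum generalizing U Y Γ with
  | zero =>
    refine .ax U Y Γ (fun g hg => ?_) fun M _ _ hM v => ?_
    · refine (hpre g hg).isQF (List.length_eq_zero_iff.1 ?_)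
      exact Multiset.sum_eq_zero_iff.1 hn _ (Multiset.mem_map_of_mem _ hg)
    · obtain ⟨g, hg, -, h⟩ := hT M hM v
      exact ⟨g, hg, h⟩
  | succ n ih =>
    have : ∃ g ∈ Γ, g.formula.pref ≠ [] := by
      by_contra hcon
      push Not at hcon
      rw [Multiset.sum_eq_zero] at hn
      · omega
      · intro m hm
        obtain ⟨g, hg, rfl⟩ := Multiset.mem_map.1 hm
        simp [hcon g hg]
    obtain ⟨⟨A, η, σ⟩, hg, hne⟩ := this
    obtain ⟨Γ, rfl⟩ := Multiset.exists_cons_of_mem hg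
    cases A with
    | lit => simp [Formula.pref] at hne
    | bin => simp [Formula.pref] at hne
    | quant q x A =>
      have step : ∀ (U Y : Finset V) (η : V → V) (σ : V → L.Term V),
          Derivable T U Y (⟨A, η, σ⟩ ::ₘ Γ) := by
        intro U Y η σ
        refine ih U Y _ ?_ (fun M _ _ hM v => ?_) ?_
        · intro g hg
          rcases Multiset.mem_cons.1 hg with rfl | hg
          · exact (hpre _ (Multiset.mem_cons_self _ _) :)
          · exact hpre g (Multiset.mem_cons_of_mem hg)
        · obtain ⟨g, hg, h⟩ := hT M hM v
          rcases Multiset.mem_cons.1 hg with rfl | hg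
          · exact h.1.elim
          · exact ⟨g, Multiset.mem_cons_of_mem hg, h⟩
        · simp [Formula.pref] at hn ⊢
          omega
      have hz := Formula.fresh_notMem Y
      cases q with
      | all => exact .all U Y Γ x A η σ _ hz (step _ _ _ _)
      | ex =>
        exact .ex U Y Γ x A η σ _ hz c.term (by simp [Constants.term]) (step _ _ _ _)

end Derivations

/-! ### From linear derivations to strict sequent proofs. -/

section DerivableToCalculus

variable {L : FirstOrder.Language.{0, 0}} {V I : Type} [DecidableEq V]

theorem exists_cons_of_map_eq_cons {α β : Type} {f : α → β} {s : Multiset α} {b : β}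
    {t : Multiset β} (h : s.map f = b ::ₘ t) : ∃ a s', s = a ::ₘ s' ∧ f a = b ∧ s'.map f = t := by
  classical
  obtain ⟨a, ha, h₁, h₂⟩ := Multiset.map_eq_cons f s t b |>.2 h
  exact ⟨a, s.erase a, (Multiset.cons_erase ha).symm, h₁, h₂⟩

theorem Formula.map_fst_pref_substAll [Infinite V] (A : Formula L V) (σ : V → L.Term V) :
    (A.substAll σ).pref.map Prod.fst = A.pref.map Prod.fst := by
  induction A generalizing σ with
  | lit => rfl
  | bin => rfl
  | quant q x A ih => simp [substAll_quant, pref, ih]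

/-- The root of a typed expansion tree. -/
def toRoot (p : ExpTree L V I × Formula L V) : Root L V I := .typed p.1 p.2

theorem typeFree_map_toRoot {Y : Finset V}
    {s : Multiset (ExpTree L V I × Formula L V)}
    (h : ∀ D ∈ s.map Prod.snd, D.free ⊆ Y) : ∀ y ∈ Forest.typeFree (s.map toRoot), y ∈ Y := by
  rintro y ⟨t, D, hD, hy⟩
  obtain ⟨⟨t', D'⟩, hp, he⟩ := Multiset.mem_map.1 hD
  obtain ⟨rfl, rfl⟩ := Root.typed.inj he
  exact h _ (Multiset.mem_map_of_mem _ hp) hy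

variable [DecidableEq I] [Infinite V]

/-- Strict provability with eigenvariables outside a finite set. -/
def ProvableAvoiding (T : Set (Formula L V)) (Y : Finset V) (F : Forest L V I) : Prop :=
  ∃ Φ : LKProof T F, Φ.IsStrict ∧ ∀ a ∈ Φ.eigenvars, a ∉ Y

variable {T : Set (Formula L V)} {Y : Finset V}

theorem ProvableAvoiding.mono {Y' : Finset V} {F : Forest L V I} (h : ProvableAvoiding T Y' F)
    (hY : Y ⊆ Y') : ProvableAvoiding T Y F :=
  let ⟨Φ, hΦ, ha⟩ := h
  ⟨Φ, hΦ, fun a h h' => ha a h (hY h')⟩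

/-- The types of the conclusion have their free variables in `Y`, and all eigenvariables from this
rule upwards lie outside `Y`; so the conclusion respects locality for each of them. For `a` itself,
`outside` ends here. -/
theorem ProvableAvoiding.allR {F : Forest L V I} {t : ExpTree L V I} {x a : V} {A : Formula L V}
    (h : ProvableAvoiding T (insert a Y) (.typed t (A.subst x (.var a)) ::ₘ F)) (ha : a ∉ Y)
    (hfree : ∀ y ∈ Forest.typeFree (.typed (.alpha a t) (.quant .all x A) ::ₘ F), y ∈ Y) :
    ProvableAvoiding T Y (.typed (.alpha a t) (.quant .all x A) ::ₘ F) := by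
  obtain ⟨Φ, hΦ, hav⟩ := h
  simp only [Finset.mem_insert, not_or] at hav
  have hav' : ∀ b ∈ a ::ₘ Φ.eigenvars, b ∉ Y := by
    intro b hb
    rcases Multiset.mem_cons.1 hb with rfl | hb
    · exact ha
    · exact (hav b hb).2
  refine ⟨.allR F t x a A Φ, ⟨hΦ.indices_nodup, ?_, fun b hb G hG hbG => ?_⟩, hav'⟩
  · exact Multiset.nodup_cons.2 ⟨fun h => (hav a h).1 rfl, hΦ.eigenvars_nodup⟩
  · rcases hG with rfl | hG
    · exact hav' b hb (hfree b hbG)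
    · split_ifs at hG with hab
      · exact hG
      · rcases Multiset.mem_cons.1 hb with rfl | hb
        · exact hab rfl
        · exact hΦ.eigenvars_local b hb G hG hbG

theorem ProvableAvoiding.exR {F : Forest L V I} {t : ExpTree L V I} {x : V} {N : L.Term V}
    {A : Formula L V} (h : ProvableAvoiding T Y (.typed t (A.subst x N) ::ₘ F))
    (hfree : ∀ y ∈ Forest.typeFree (I := I)
      (.typed (.expand (.eps N t)) (.quant .ex x A) ::ₘ F), y ∈ Y) :
    ProvableAvoiding T Y (.typed (.expand (.eps N t)) (.quant .ex x A) ::ₘ F) := by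
  obtain ⟨Φ, hΦ, hav⟩ := h
  refine ⟨.exR F t x N A Φ,
    ⟨hΦ.indices_nodup, hΦ.eigenvars_nodup, fun b hb G hG hbG => ?_⟩, hav⟩
  rcases hG with rfl | hG
  · exact hav b hb (hfree b hbG)
  · exact hΦ.eigenvars_local b hb G hG hbG

theorem ProvableAvoiding.contrEx {F : Forest L V I} {t s : WitSum L V I} {x : V}
    {A : Formula L V} (h : ProvableAvoiding T Y (.typed (.expand t) (.quant .ex x A) ::ₘ
      .typed (.expand s) (.quant .ex x A) ::ₘ F))
    (hfree : ∀ y ∈ Forest.typeFree (.typed (.expand (t.add s)) (.quant .ex x A) ::ₘ F), y ∈ Y) :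
    ProvableAvoiding T Y (.typed (.expand (t.add s)) (.quant .ex x A) ::ₘ F) := by
  obtain ⟨Φ, hΦ, hav⟩ := h
  refine ⟨.contrEx F t s x A Φ,
    ⟨hΦ.indices_nodup, hΦ.eigenvars_nodup, fun b hb G hG hbG => ?_⟩, hav⟩
  rcases hG with rfl | hG
  · exact hav b hb (hfree b hbG)
  · exact hΦ.eigenvars_local b hb G hG hbG

/-- The formula `D` is obtained from the instance `g` by carrying out the substitution, up to
renaming of bound variables. -/
structure Instance.Tracks (g : Instance L V) (D : Formula L V) : Prop where
  prenex : D.IsPrenex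
  shape : D.pref.map Prod.fst = g.formula.pref.map Prod.fst
  holdsAlong : ∀ {M : Type} [L.Structure M] (v : V → M) (ms : List M),
    D.HoldsAlong v ms ↔ g.formula.HoldsAlong (fun x => (g.value x).realize v) ms

/-- Put the value of `N` at the head of the list of elements. Equivalence of two quantified formulae
alone would say nothing about their bodies, which is why `Tracks` speaks of `HoldsAlong`. -/
theorem Instance.Tracks.quant {q : Quantifier} {x : V} {A D : Formula L V} {η : V → V}
    {σ : V → L.Term V} (h : Instance.Tracks ⟨.quant q x A, η, σ⟩ D) :
    ∃ y B, D = .quant q y B ∧ ∀ (N : L.Term V) (η' : V → V),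
      Instance.Tracks ⟨A, η', Function.update σ x N⟩ (B.subst y N) := by
  obtain ⟨hpre, hshape, hholds⟩ := h
  cases D with
  | lit => simp [Formula.pref] at hshape
  | bin => simp [Formula.pref] at hshape
  | quant q' y B =>
    simp only [Formula.pref, List.map_cons, List.cons.injEq] at hshape
    obtain ⟨rfl, hshape⟩ := hshape
    refine ⟨y, B, rfl, fun N η' => ⟨(Formula.isPrenex_substAll _).2 hpre, ?_, fun v ms => ?_⟩⟩
    · rw [Formula.subst, Formula.map_fst_pref_substAll, hshape]
    · have h := hholds v (N.realize v :: ms)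
      simp only [Formula.HoldsAlong] at h
      rw [Formula.holdsAlong_subst, h]
      refine Formula.holdsAlong_congr _ _ fun u _ => ?_
      by_cases hu : u = x
      · subst hu; simp
      · simp [hu]

/-- The values of the instances are carried out as substitutions in the types. Types are only
tracked, since iterated capture-avoiding substitution agrees with a simultaneous one only up to
renaming. The condition on existential roots provides the formal sums that `contrEx` adds. -/
theorem Derivable.provableAvoiding [Nonempty I] {U : Finset V} {Γ : Multiset (Instance L V)}
    (h : Derivable T U Y Γ) (hUY : U ⊆ Y) (G : Multiset (Instance L V × Formula L V))
    (hG : G.map Prod.fst = Γ) (hG' : ∀ p ∈ G, p.1.Tracks p.2 ∧ p.2.free ⊆ U) :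
    ∃ s : Multiset (ExpTree L V I × Formula L V), s.map Prod.snd = G.map Prod.snd ∧
      (∀ p ∈ s, ∀ x A, p.2 = .quant .ex x A → ∃ w, p.1 = .expand w) ∧
      ProvableAvoiding T Y (s.map toRoot) := by
  have free_cons : ∀ {U Y : Finset V} {g : Instance L V} {D : Formula L V}
      {G : Multiset (Instance L V × Formula L V)} {s : Multiset (ExpTree L V I × Formula L V)}
      (t : ExpTree L V I), U ⊆ Y → (∀ p ∈ (g, D) ::ₘ G, p.1.Tracks p.2 ∧ p.2.free ⊆ U) →
      s.map Prod.snd = G.map Prod.snd →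
      ∀ y ∈ Forest.typeFree (.typed t D ::ₘ s.map toRoot), y ∈ Y := by
    intro U Y g D G s t hUY hG' hs y hy
    refine typeFree_map_toRoot (s := (t, D) ::ₘ s) (fun B hB => ?_) y
      (by rw [Multiset.map_cons]; exact hy)
    rw [Multiset.map_cons, hs, ← Multiset.map_cons Prod.snd (g, D)] at hB
    obtain ⟨p, hp, rfl⟩ := Multiset.mem_map.1 hB
    exact (hG' p hp).2.trans hUY
  induction h generalizing G with
  | ax U Y Γ hqf hT =>
    -- The derivation does not branch, so the proof has a single tautology rule and any index will
    -- do.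
    obtain ⟨i⟩ := ‹Nonempty I›
    have hq : ∀ p ∈ G, p.2.IsQF := by
      intro p hp
      have ht := (hG' p hp).1
      refine ht.prenex.isQF ?_
      have := ht.shape
      rw [(hqf p.1 (hG ▸ Multiset.mem_map_of_mem _ hp)).pref_eq_nil] at this
      simpa using this
    refine ⟨(G.map Prod.snd).map fun D => (.leaf {i} (Finset.singleton_nonempty i), D),
      by simp, ?_, ?_⟩
    · intro p hp x A hA
      simp only [Multiset.map_map, Multiset.mem_map] at hp
      obtain ⟨p', hp', rfl⟩ := hp
      have := hq p' hp'
      simp only [Function.comp] at hA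
      rw [hA] at this
      exact this.elim
    · have hP : ∀ P ∈ G.map Prod.snd, P.IsQF := by
        intro P hP
        obtain ⟨p, hp, rfl⟩ := Multiset.mem_map.1 hP
        exact hq p hp
      have hE : EntailsOr T (G.map Prod.snd) := by
        intro M _ _ hM v
        obtain ⟨g, hg, h⟩ := hT M hM v
        rw [← hG] at hg
        obtain ⟨p, hp, rfl⟩ := Multiset.mem_map.1 hg
        refine ⟨p.2, Multiset.mem_map_of_mem _ hp, ?_⟩
        rw [← Formula.holdsAlong_nil, (hG' p hp).1.holdsAlong, Formula.holdsAlong_nil]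
        exact h
      rw [Multiset.map_map]
      refine ⟨.taut i (G.map Prod.snd) hP hE, ⟨?_, ?_, ?_⟩, ?_⟩ <;>
        simp [LKProof.indices, LKProof.eigenvars]
  | all U Y Γ x A η σ a ha _ ih =>
    obtain ⟨⟨g, D⟩, G, rfl, rfl, rfl⟩ := exists_cons_of_map_eq_cons hG
    have hg := hG' _ (Multiset.mem_cons_self _ _)
    obtain ⟨y, B, rfl, ht⟩ := hg.1.quant
    obtain ⟨s, hs, hsum, hp⟩ := ih (Finset.insert_subset_insert a hUY)
      ((_, B.subst y (.var a)) ::ₘ G) (by rw [Multiset.map_cons]) (by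
        intro p hp
        rcases Multiset.mem_cons.1 hp with rfl | hp
        · refine ⟨ht _ _, (Formula.free_subst_subset _ _ _).trans ?_⟩
          refine Finset.union_subset (hg.2.trans (Finset.subset_insert _ _)) ?_
          simp
        · have := hG' p (Multiset.mem_cons_of_mem hp)
          exact ⟨this.1, this.2.trans (Finset.subset_insert _ _)⟩)
    simp only [Multiset.map_cons] at hs
    obtain ⟨⟨t, D⟩, s, rfl, rfl, hs₂⟩ := exists_cons_of_map_eq_cons hs
    rw [Multiset.map_cons] at hp
    refine ⟨(.alpha a t, .quant .all y B) ::ₘ s, by simp [hs₂], ?_, ?_⟩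
    · intro p hp x A hA
      rcases Multiset.mem_cons.1 hp with rfl | hp
      · simp at hA
      · exact hsum p (Multiset.mem_cons_of_mem hp) x A hA
    · rw [Multiset.map_cons]
      exact ProvableAvoiding.allR hp ha (free_cons _ hUY hG' hs₂)
  | ex U Y Γ x A η σ z hz N hN _ ih =>
    obtain ⟨⟨g, D⟩, G, rfl, rfl, rfl⟩ := exists_cons_of_map_eq_cons hG
    have hg := hG' _ (Multiset.mem_cons_self _ _)
    obtain ⟨y, B, rfl, ht⟩ := hg.1.quant
    obtain ⟨s, hs, hsum, hp⟩ := ih (hUY.trans (Finset.subset_insert _ _))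
      ((_, B.subst y N) ::ₘ G) (by rw [Multiset.map_cons]) (by
        intro p hp
        rcases Multiset.mem_cons.1 hp with rfl | hp
        · exact ⟨ht _ _, (Formula.free_subst_subset _ _ _).trans (Finset.union_subset hg.2 hN)⟩
        · exact hG' p (Multiset.mem_cons_of_mem hp))
    simp only [Multiset.map_cons] at hs
    obtain ⟨⟨t, D⟩, s, rfl, rfl, hs₂⟩ := exists_cons_of_map_eq_cons hs
    rw [Multiset.map_cons] at hp
    refine ⟨(.expand (.eps N t), .quant .ex y B) ::ₘ s, by simp [hs₂], ?_, ?_⟩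
    · intro p hp x A hA
      rcases Multiset.mem_cons.1 hp with rfl | hp
      · exact ⟨_, rfl⟩
      · exact hsum p (Multiset.mem_cons_of_mem hp) x A hA
    · rw [Multiset.map_cons]
      exact ProvableAvoiding.exR (hp.mono (Finset.subset_insert _ _)) (free_cons _ hUY hG' hs₂)
  | contr U Y Γ x A η σ _ ih =>
    obtain ⟨⟨g, D⟩, G, rfl, rfl, rfl⟩ := exists_cons_of_map_eq_cons hG
    have hg := hG' _ (Multiset.mem_cons_self _ _)
    obtain ⟨y, B, rfl, -⟩ := hg.1.quant
    obtain ⟨s, hs, hsum, hp⟩ := ih hUY ((_, .quant .ex y B) ::ₘ (_, .quant .ex y B) ::ₘ G)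
      (by rw [Multiset.map_cons, Multiset.map_cons]) (by
        intro p hp
        rcases Multiset.mem_cons.1 hp with rfl | hp
        · exact hg
        · exact hG' p hp)
    simp only [Multiset.map_cons] at hs
    obtain ⟨⟨t, D⟩, s, rfl, rfl, hs₁⟩ := exists_cons_of_map_eq_cons hs
    obtain ⟨⟨t', D⟩, s, rfl, rfl, hs₂⟩ := exists_cons_of_map_eq_cons hs₁
    obtain ⟨w, hw⟩ := hsum _ (Multiset.mem_cons_self _ _) _ _ rfl
    obtain ⟨w', hw'⟩ := hsum _ (Multiset.mem_cons_of_mem (Multiset.mem_cons_self _ _)) _ _ rfl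
    simp only at hw hw'
    subst hw hw'
    rw [Multiset.map_cons, Multiset.map_cons] at hp
    refine ⟨(.expand (w.add w'), .quant .ex y B) ::ₘ s, by simp [hs₂], ?_, ?_⟩
    · intro p hp x A hA
      rcases Multiset.mem_cons.1 hp with rfl | hp
      · exact ⟨_, rfl⟩
      · exact hsum p (Multiset.mem_cons_of_mem (Multiset.mem_cons_of_mem hp)) x A hA
    · rw [Multiset.map_cons]
      exact ProvableAvoiding.contrEx hp (free_cons _ hUY hG' hs₂)

theorem Derivable.lkProvable [Nonempty I] {A : Formula L V} (hA : A.IsPrenex)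
    (hclosed : A.IsClosed) {η : V → V} {σ : V → L.Term V}
    (h : Derivable T ∅ Y {⟨A, η, σ⟩}) :
    ∃ t : ExpTree L V I, LKProvable T {Root.typed t A} := by
  obtain ⟨s, hs, -, Φ, hΦ, -⟩ := h.provableAvoiding (I := I) (Finset.empty_subset Y)
    {(⟨A, η, σ⟩, A)} (by simp) (by
      intro p hp
      rw [Multiset.mem_singleton.1 hp]
      exact ⟨⟨hA, rfl, fun v ms => Formula.holdsAlong_congr _ _ (by simp [show A.free = ∅ from hclosed])⟩,
        Finset.subset_empty.2 hclosed⟩)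
  rw [Multiset.map_singleton, Multiset.map_eq_singleton] at hs
  obtain ⟨⟨t, D⟩, rfl, rfl⟩ := hs
  exact ⟨t, Φ, hΦ⟩

end DerivableToCalculus

/-! ### Expansion and prenexification as rewriting. -/

section Rewriting

variable {L : FirstOrder.Language.{0, 0}} {V : Type}

theorem IsExpansion.trans {A B C : Formula L V} (h₁ : IsExpansion A B) (h₂ : IsExpansion B C) :
    IsExpansion A C := by
  induction h₂ with
  | refl => exact h₁
  | step D x E _ ih => exact .step D x E ih

theorem IsExpansion.quant (q : Quantifier) (x : V) {A B : Formula L V} (h : IsExpansion A B) :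
    IsExpansion (.quant q x A) (.quant q x B) := by
  induction h with
  | refl => exact .refl
  | step D y E _ ih => exact .step (.quant q x D) y E ih

theorem IsExpansion.bin (c : Connective) {A A' B B' : Formula L V} (hA : IsExpansion A A')
    (hB : IsExpansion B B') : IsExpansion (.bin c A B) (.bin c A' B') := by
  have h₁ : IsExpansion (.bin c A B) (.bin c A' B) := by
    clear hB
    induction hA with
    | refl => exact .refl
    | step D y E _ ih => exact .step (.binL c D B) y E ih
  refine h₁.trans ?_
  induction hB with
  | refl => exact .refl
  | step D y E _ ih => exact .step (.binR c A' D) y E ih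

theorem prenexSteps_quant (q : Quantifier) (x : V) {A B : Formula L V}
    (h : Relation.ReflTransGen PrenexStep A B) :
    Relation.ReflTransGen PrenexStep (.quant q x A) (.quant q x B) := by
  refine h.lift (Formula.quant q x) fun A B h => ?_
  cases h with
  | right C c q' y A B => exact .right (.quant q x C) c q' y A B
  | left C c q' y A B => exact .left (.quant q x C) c q' y A B

theorem prenexSteps_binL (c : Connective) (D : Formula L V) {A B : Formula L V}
    (h : Relation.ReflTransGen PrenexStep A B) :
    Relation.ReflTransGen PrenexStep (.bin c A D) (.bin c B D) := by
  refine h.lift (Formula.bin c · D) fun A B h => ?_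
  cases h with
  | right C c' q' y A B => exact .right (.binL c C D) c' q' y A B
  | left C c' q' y A B => exact .left (.binL c C D) c' q' y A B

theorem prenexSteps_binR (c : Connective) (D : Formula L V) {A B : Formula L V}
    (h : Relation.ReflTransGen PrenexStep A B) :
    Relation.ReflTransGen PrenexStep (.bin c D A) (.bin c D B) := by
  refine h.lift (Formula.bin c D) fun A B h => ?_
  cases h with
  | right C c' q' y A B => exact .right (.binR c D C) c' q' y A B
  | left C c' q' y A B => exact .left (.binR c D C) c' q' y A B

/-- `OrTree R s`: the formula `R` is built by disjunctions from the members of `s`. -/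
inductive OrTree : Formula L V → Multiset (Formula L V) → Prop
  | leaf (D : Formula L V) : OrTree D {D}
  | node {R R' : Formula L V} {s s' : Multiset (Formula L V)} :
      OrTree R s → OrTree R' s' → OrTree (.bin .or R R') (s + s')

theorem add_eq_cons {α : Type} {s t u : Multiset α} {a : α} (h : s + t = a ::ₘ u) :
    (∃ s', s = a ::ₘ s' ∧ u = s' + t) ∨ ∃ t', t = a ::ₘ t' ∧ u = s + t' := by
  have ha : a ∈ s + t := h ▸ Multiset.mem_cons_self a u
  rcases Multiset.mem_add.1 ha with hs | ht
  · obtain ⟨s', rfl⟩ := Multiset.exists_cons_of_mem hs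
    rw [Multiset.cons_add, Multiset.cons_inj_right] at h
    exact Or.inl ⟨s', rfl, h.symm⟩
  · obtain ⟨t', rfl⟩ := Multiset.exists_cons_of_mem ht
    rw [Multiset.add_cons, Multiset.cons_inj_right] at h
    exact Or.inr ⟨t', rfl, h.symm⟩

/-- Under any bracketing, a quantifier at the head of one disjunct climbs to the root by successive
shifts past its siblings. -/
theorem OrTree.pull {R : Formula L V} {s Δ : Multiset (Formula L V)} {q : Quantifier} {x : V}
    {D : Formula L V} (h : OrTree R s) (hs : s = .quant q x D ::ₘ Δ) :
    ∃ R', OrTree R' (D ::ₘ Δ) ∧ Relation.ReflTransGen PrenexStep R (.quant q x R') := by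
  induction h generalizing Δ with
  | leaf E =>
    obtain ⟨rfl, rfl⟩ : E = .quant q x D ∧ Δ = 0 := by
      simpa [Multiset.singleton_eq_cons_iff, eq_comm] using hs
    exact ⟨D, .leaf D, .refl⟩
  | @node R R' s s' hR hR' ih ih' =>
    rcases add_eq_cons hs with ⟨s₁, rfl, rfl⟩ | ⟨s₁, rfl, rfl⟩
    · obtain ⟨R₁, h₁, h₂⟩ := ih rfl
      refine ⟨.bin .or R₁ R', ?_, (prenexSteps_binL _ _ h₂).tail (.left .hole _ _ _ _ _)⟩
      rw [← Multiset.cons_add]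
      exact h₁.node hR'
    · obtain ⟨R₁, h₁, h₂⟩ := ih' rfl
      refine ⟨.bin .or R R₁, ?_, (prenexSteps_binR _ _ h₂).tail (.right .hole _ _ _ _ _)⟩
      rw [← Multiset.add_cons]
      exact hR.node h₁

/-- A leaf that is itself a disjunction may be read as an inner node; this is how a contraction acts
on copies. -/
theorem OrTree.split {R : Formula L V} {s Δ : Multiset (Formula L V)} {D E : Formula L V}
    (h : OrTree R s) (hs : s = .bin .or D E ::ₘ Δ) : OrTree R (D ::ₘ E ::ₘ Δ) := by
  induction h generalizing Δ with
  | leaf E' =>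
    obtain ⟨rfl, rfl⟩ : E' = .bin .or D E ∧ Δ = 0 := by
      simpa [Multiset.singleton_eq_cons_iff, eq_comm] using hs
    exact (OrTree.leaf D).node (.leaf E)
  | @node R R' s s' hR hR' ih ih' =>
    rcases add_eq_cons hs with ⟨s₁, rfl, rfl⟩ | ⟨s₁, rfl, rfl⟩
    · rw [← Multiset.cons_add, ← Multiset.cons_add]
      exact (ih rfl).node hR'
    · rw [← Multiset.add_cons, ← Multiset.add_cons]
      exact hR.node (ih' rfl)

theorem OrTree.isQF {R : Formula L V} {s : Multiset (Formula L V)} (h : OrTree R s)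
    (hs : ∀ D ∈ s, D.IsQF) : R.IsQF := by
  induction h with
  | leaf D => exact hs D (Multiset.mem_singleton_self D)
  | node _ _ ih ih' =>
    exact ⟨ih fun D hD => hs D (Multiset.mem_add.2 (Or.inl hD)),
      ih' fun D hD => hs D (Multiset.mem_add.2 (Or.inr hD))⟩

theorem OrTree.holds [DecidableEq V] {R : Formula L V} {s : Multiset (Formula L V)}
    (h : OrTree R s) {M : Type} [L.Structure M] (v : V → M) {D : Formula L V} (hD : D ∈ s)
    (hv : D.Holds v) : R.Holds v := by
  induction h with
  | leaf E => exact Multiset.mem_singleton.1 hD ▸ hv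
  | node _ _ ih ih' => exact (Multiset.mem_add.1 hD).imp ih ih'

theorem Formula.IsQF.matrix_eq {A : Formula L V} (hA : A.IsQF) : A.matrix = A := by
  cases A with
  | lit => rfl
  | bin => rfl
  | quant => exact hA.elim

end Rewriting

/-! ### From linear derivations to Herbrand proofs. -/

section Copies

variable {L : FirstOrder.Language.{0, 0}} {V : Type}

/-- The variables bound in the copies of a multiset of instances. -/
def copyBinders (s : Multiset (Instance L V × Formula L V)) : Multiset V :=
  s.bind fun p => (p.2.binders : Multiset V)

theorem copyBinders_cons (p : Instance L V × Formula L V)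
    (s : Multiset (Instance L V × Formula L V)) :
    copyBinders (p ::ₘ s) = (p.2.binders : Multiset V) + copyBinders s :=
  Multiset.cons_bind _ _ _

variable [DecidableEq V] [Infinite V]

/-- `Copy A η D`: the formula `D` is an expansion of the prenex formula `A`, with bound variables
renamed and free variables renamed according to `η`. -/
inductive Copy : Formula L V → (V → V) → Formula L V → Prop
  | qf (A : Formula L V) (η : V → V) : A.IsQF → Copy A η (A.substAll fun x => .var (η x))
  | quant (q : Quantifier) (x : V) (A : Formula L V) (η : V → V) (z : V) (D : Formula L V) :
      (∀ y ∈ (Formula.quant q x A).free, z ≠ η y) → Copy A (Function.update η x z) D →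
      Copy (.quant q x A) η (.quant q z D)
  | or (x : V) (A : Formula L V) (η : V → V) (D E : Formula L V) :
      Copy (.quant .ex x A) η D → Copy (.quant .ex x A) η E →
      Copy (.quant .ex x A) η (.bin .or D E)

theorem Copy.free_subset {A D : Formula L V} {η : V → V} (h : Copy A η D) :
    D.free ⊆ A.free.image η := by
  induction h with
  | qf A η =>
    intro y hy
    rw [Formula.free_substAll] at hy
    simpa [eq_comm] using hy
  | quant q x A η z D hz _ ih =>
    intro y hy
    obtain ⟨hyz, hy⟩ := Finset.mem_erase.1 hy
    obtain ⟨u, hu, rfl⟩ := Finset.mem_image.1 (ih hy)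
    have hux : u ≠ x := by
      rintro rfl
      simp at hyz
    exact Finset.mem_image.2 ⟨u, by simp [Formula.free, hu, hux], by simp [hux]⟩
  | or x A η D E _ _ ih₁ ih₂ => exact Finset.union_subset ih₁ ih₂

/-- A `Copy` duplicates and renames at once; here all duplications are moved before the renaming.
`B` has the shape of `D` with the variables of `A`, and its having the same free variables as `A`
transfers the freshness conditions. -/
theorem Copy.exists_isExpansion {A D : Formula L V} {η : V → V} (h : Copy A η D) :
    ∃ B, IsExpansion A B ∧ B.free = A.free ∧ AlphaEq (B.substAll fun x => .var (η x)) D := by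
  induction h with
  | qf A η => exact ⟨A, .refl, rfl, .refl _⟩
  | quant q x A η z D hz _ ih =>
    obtain ⟨B, h₁, h₂, h₃⟩ := ih
    have hfree : (Formula.quant q x B).free = (Formula.quant q x A).free := by
      simp only [Formula.free, h₂]
    refine ⟨.quant q x B, h₁.quant q x, hfree, ?_⟩
    rw [Formula.substAll_quant]
    set y := B.bound x fun x => .var (η x) with hy
    refine (AlphaEq.rename q y z _ ?_).trans (.quant q z (AlphaEq.trans ?_ h₃))
    · rw [hy, ← Formula.substAll_quant, Formula.free_substAll, hfree]
      simp only [Term.varFinset, Finset.mem_biUnion, Finset.mem_singleton, not_exists, not_and]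
      exact hz
    · refine (alphaEq_substAll_substAll _ _ _).trans (.of_eq (Formula.substAll_congr _ ?_))
      intro u hu
      by_cases hux : u = x
      · subst hux; simp [Term.subst]
      · have hne : η u ≠ y := by
          have := B.bound_notMem_varFinset x (fun x => .var (η x)) hu hux
          rw [← hy] at this
          simpa [eq_comm] using this
        simp [hux, Term.subst, hne]
  | or x A η D E _ _ ih₁ ih₂ =>
    obtain ⟨B, h₁, h₂, h₃⟩ := ih₁
    obtain ⟨B', h₁', h₂', h₃'⟩ := ih₂
    -- Duplicate at the root, then expand the two halves independently.
    exact ⟨.bin .or B B', (IsExpansion.step .hole x A .refl).trans (h₁.bin .or h₁'),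
      by simp [Formula.free] at h₂ h₂' ⊢; simp [h₂, h₂'], .bin .or h₃ h₃'⟩

variable {T : Set (Formula L V)}

/-- The instances in `Γ` have copies with distinct new bound variables such that every disjunction
of the copies can be brought into a prenex form that has a list of witnesses. -/
def HasCopies (T : Set (Formula L V)) (U Y : Finset V) (Γ : Multiset (Instance L V)) : Prop :=
  ∃ s : Multiset (Instance L V × Formula L V), s.map Prod.fst = Γ ∧
    (∀ p ∈ s, Copy p.1.formula p.1.name p.2) ∧
    (copyBinders s).Nodup ∧ (∀ x ∈ copyBinders s, x ∉ Y) ∧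
    ∀ (R : Formula L V) (τ : V → L.Term V), OrTree R (s.map Prod.snd) →
      (∀ g ∈ Γ, ∀ y ∈ g.formula.free, τ (g.name y) = g.value y) →
      ∃ (R' : Formula L V) (ws : List (L.Term V)),
        Relation.ReflTransGen PrenexStep R R' ∧ R'.IsPrenex ∧ WitnessList U R'.pref ws ∧
        ∀ (M : Type) [Nonempty M] [L.Structure M],
          (∀ B ∈ T, ∀ v : V → M, B.Holds v) →
            ∀ v : V → M, R'.matrix.Holds fun x => (extend τ R'.pref ws x).realize v

/-- Treats both quantifiers, which differ only in `hw`. The new quantifier is pulled out of `R`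
before anything else, so it comes first in the prefix; since `z ∉ Y`, updating `τ` at `z` leaves the
values of all earlier names unchanged. -/
theorem HasCopies.quant {U U' Y : Finset V} {Γ : Multiset (Instance L V)} {q : Quantifier} {x : V}
    {A : Formula L V} {η : V → V} {σ : V → L.Term V} {z : V} {N : L.Term V} (hz : z ∉ Y)
    (hw : ∀ p ws, WitnessList U' p ws → WitnessList U ((q, z) :: p) (N :: ws))
    (hY : ∀ g ∈ Instance.mk (.quant q x A) η σ ::ₘ Γ, ∀ y ∈ g.formula.free, g.name y ∈ Y)
    (ih : (∀ g ∈ Instance.mk A (Function.update η x z) (Function.update σ x N) ::ₘ Γ,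
      ∀ y ∈ g.formula.free, g.name y ∈ insert z Y) →
      HasCopies T U' (insert z Y) (⟨A, Function.update η x z, Function.update σ x N⟩ ::ₘ Γ)) :
    HasCopies T U Y (⟨.quant q x A, η, σ⟩ ::ₘ Γ) := by
  have hY₁ := hY _ (Multiset.mem_cons_self _ _)
  obtain ⟨s, hs, hcopy, hnd, hav, hR⟩ := ih (by
    intro g hg y hy
    rcases Multiset.mem_cons.1 hg with rfl | hg
    · by_cases hyx : y = x
      · subst hyx; simp
      · simp only [Function.update_of_ne hyx]
        exact Finset.mem_insert_of_mem (hY₁ y (Finset.mem_erase.2 ⟨hyx, hy⟩))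
    · exact Finset.mem_insert_of_mem (hY g (Multiset.mem_cons_of_mem hg) y hy))
  obtain ⟨⟨g, D⟩, s, rfl, rfl, hs₂⟩ := exists_cons_of_map_eq_cons hs
  rw [copyBinders_cons] at hnd hav
  refine ⟨(⟨.quant q x A, η, σ⟩, .quant q z D) ::ₘ s, by simp [hs₂], ?_, ?_, ?_, ?_⟩
  · intro p hp
    rcases Multiset.mem_cons.1 hp with rfl | hp
    · refine .quant q x A η z D (fun y hy h => hz ?_) (hcopy _ (Multiset.mem_cons_self _ _))
      rw [h]
      exact hY₁ y hy
    · exact hcopy p (Multiset.mem_cons_of_mem hp)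
  · rw [copyBinders_cons, Formula.binders, ← Multiset.cons_coe, Multiset.cons_add,
      Multiset.nodup_cons]
    exact ⟨fun h => hav z h (Finset.mem_insert_self _ _), hnd⟩
  · intro y hy
    rw [copyBinders_cons, Formula.binders, ← Multiset.cons_coe, Multiset.cons_add,
      Multiset.mem_cons] at hy
    rcases hy with rfl | hy
    · exact hz
    · exact fun h => hav y hy (Finset.mem_insert_of_mem h)
  · intro R τ hRs hτ
    rw [Multiset.map_cons] at hRs
    obtain ⟨R₁, h₁, h₂⟩ := hRs.pull rfl
    obtain ⟨R', ws, h₃, h₄, h₅, h₆⟩ := hR R₁ (Function.update τ z N)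
      (by rw [Multiset.map_cons]; exact h₁) (by
        intro g hg y hy
        rcases Multiset.mem_cons.1 hg with rfl | hg
        · by_cases hyx : y = x
          · subst hyx; simp
          · have hy' : y ∈ (Formula.quant q x A).free := Finset.mem_erase.2 ⟨hyx, hy⟩
            have hne : η y ≠ z := fun h => hz (h ▸ hY₁ y hy')
            simpa [hyx, hne] using hτ _ (Multiset.mem_cons_self _ _) y hy'
        · have hne : g.name y ≠ z := fun h =>
            hz (h ▸ hY g (Multiset.mem_cons_of_mem hg) y hy)
          simpa [hne] using hτ g (Multiset.mem_cons_of_mem hg) y hy)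
    exact ⟨.quant q z R', N :: ws, h₂.trans (prenexSteps_quant q z h₃), h₄, hw _ _ h₅, h₆⟩

/-- A contraction joins two copies with disjoint new binders into one disjunction. This alters the
bracketing of the leaves, and is harmless because `HasCopies` admits every `OrTree` over the copies.
-/
theorem Derivable.hasCopies {U Y : Finset V} {Γ : Multiset (Instance L V)}
    (h : Derivable T U Y Γ) (hY : ∀ g ∈ Γ, ∀ y ∈ g.formula.free, g.name y ∈ Y) :
    HasCopies T U Y Γ := by
  induction h with
  | ax U Y Γ hqf hT =>
    have hqf' : ∀ p ∈ Γ.map fun g => (g, g.formula.substAll fun x => .var (g.name x)),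
        p.2.IsQF := by
      intro p hp
      obtain ⟨g, hg, rfl⟩ := Multiset.mem_map.1 hp
      exact (Formula.isQF_substAll _).2 (hqf g hg)
    have hb : copyBinders (Γ.map fun g => (g, g.formula.substAll fun x => .var (g.name x))) = 0 := by
      refine Multiset.eq_zero_of_forall_notMem fun y hy => ?_
      obtain ⟨p, hp, hy⟩ := Multiset.mem_bind.1 hy
      have hq := hqf' p hp
      rw [Formula.binders_eq_map_pref hq.isPrenex, hq.pref_eq_nil] at hy
      simp at hy
    refine ⟨Γ.map fun g => (g, g.formula.substAll fun x => .var (g.name x)), by simp, ?_,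
      by simp [hb], by simp [hb], fun R τ hR hτ => ?_⟩
    · intro p hp
      obtain ⟨g, hg, rfl⟩ := Multiset.mem_map.1 hp
      exact .qf _ _ (hqf g hg)
    · have hRq := hR.isQF (by
        intro D hD
        obtain ⟨p, hp, rfl⟩ := Multiset.mem_map.1 hD
        exact hqf' p hp)
      refine ⟨R, [], .refl, hRq.isPrenex, ?_, fun M _ _ hM v => ?_⟩
      · rw [hRq.pref_eq_nil]; trivial
      · obtain ⟨g, hg, hv⟩ := hT M hM v
        rw [hRq.pref_eq_nil, hRq.matrix_eq]
        refine hR.holds _ (D := g.formula.substAll fun x => .var (g.name x)) ?_ ?_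
        · rw [Multiset.map_map]
          exact Multiset.mem_map_of_mem _ hg
        · rw [Formula.holds_substAll]
          refine (Formula.holds_congr _ fun y hy => ?_).1 hv
          simp [extend, hτ g hg y hy]
  | all U Y Γ x A η σ a ha _ ih => exact .quant ha (fun p ws h => ⟨rfl, h⟩) hY ih
  | ex U Y Γ x A η σ z hz N hN _ ih => exact .quant hz (fun p ws h => ⟨hN, h⟩) hY ih
  | contr U Y Γ x A η σ _ ih =>
    have hΓ : ∀ {P : Instance L V → Prop}, (∀ g ∈ Instance.mk (.quant .ex x A) η σ ::ₘ Γ, P g) →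
        ∀ g ∈ Instance.mk (.quant .ex x A) η σ ::ₘ Instance.mk (.quant .ex x A) η σ ::ₘ Γ, P g := by
      intro P h g hg
      rcases Multiset.mem_cons.1 hg with rfl | hg
      · exact h _ (Multiset.mem_cons_self _ _)
      · exact h g hg
    obtain ⟨s, hs, hcopy, hnd, hav, hR⟩ := ih (hΓ hY)
    obtain ⟨⟨g, D⟩, s, rfl, rfl, hs₁⟩ := exists_cons_of_map_eq_cons hs
    obtain ⟨⟨g, E⟩, s, rfl, rfl, hs₂⟩ := exists_cons_of_map_eq_cons hs₁
    rw [copyBinders_cons, copyBinders_cons, ← add_assoc, Multiset.coe_add] at hnd hav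
    refine ⟨(⟨.quant .ex x A, η, σ⟩, .bin .or D E) ::ₘ s, by simp [hs₂], ?_, ?_, ?_, ?_⟩
    · intro p hp
      rcases Multiset.mem_cons.1 hp with rfl | hp
      · exact .or x A η D E (hcopy _ (Multiset.mem_cons_self _ _))
          (hcopy _ (Multiset.mem_cons_of_mem (Multiset.mem_cons_self _ _)))
      · exact hcopy p (Multiset.mem_cons_of_mem (Multiset.mem_cons_of_mem hp))
    · rw [copyBinders_cons]
      exact hnd
    · rw [copyBinders_cons]
      exact hav
    · intro R τ hRs hτ
      rw [Multiset.map_cons] at hRs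
      refine hR R τ ?_ (hΓ hτ)
      rw [Multiset.map_cons, Multiset.map_cons]
      exact hRs.split rfl

theorem Derivable.nonempty_herbrandProof {A : Formula L V} (hclosed : A.IsClosed)
    {Y : Finset V} {σ : V → L.Term V} (h : Derivable T ∅ Y {⟨A, id, σ⟩}) : Nonempty (HerbrandProof T A) := by
  have hfree : ∀ g ∈ ({⟨A, id, σ⟩} : Multiset (Instance L V)), g.formula.free = ∅ := by
    intro g hg
    rw [Multiset.mem_singleton.1 hg]
    exact hclosed
  obtain ⟨s, hs, hcopy, hnd, -, hR⟩ := h.hasCopies (by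
    intro g hg y hy
    simp [hfree g hg] at hy)
  obtain ⟨⟨g, A'⟩, rfl, rfl⟩ := Multiset.map_eq_singleton.1 hs
  have hc := hcopy _ (Multiset.mem_singleton_self _)
  obtain ⟨R, ws, h₁, h₂, h₃, h₄⟩ := hR A' .var (by
    rw [Multiset.map_singleton]; exact .leaf A') (by
    intro g hg y hy
    simp [hfree g hg] at hy)
  obtain ⟨B, hB, -, hα⟩ := hc.exists_isExpansion
  have hA' : A'.free = ∅ := by
    refine Finset.subset_empty.1 (hc.free_subset.trans ?_)
    rw [show A.free = ∅ from hclosed]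
    simp
  have hlen := h₃.length_eq
  have hws : List.ofFn (fun i : Fin R.pref.length => ws.get (i.cast hlen.symm)) = ws := by
    refine List.ext_get (by simp [hlen]) fun n h₁ h₂ => by simp
  refine ⟨⟨B, R, fun i => ws.get (i.cast hlen.symm), hB, ⟨A', ?_, ?_, ?_, h₁, h₂⟩, ?_⟩⟩
  · have : AlphaEq (B.substAll .var) A' := hα
    rwa [Formula.substAll_var] at this
  · simpa [copyBinders] using hnd
  · simp [hA']
  · have hw := (witnessList_iff ∅ R.pref fun i => ws.get (i.cast hlen.symm)).1 (by rwa [hws])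
    refine ⟨hw.1, fun j hj y hy => (hw.2 j hj y hy).resolve_left (by simp), ?_⟩
    intro M _ _ hM v
    refine ⟨_, Multiset.mem_singleton_self _, ?_⟩
    rw [Formula.holds_substAll, prefixSubst, foldl_update_eq_extend, hws]
    exact h₄ M hM v

end Copies

/-! ### The Herbrand universe and its compact space of valuations. -/

/-- The Herbrand universe. Besides the terms, it contains codes of the nodes of the tree of all
instantiations of the quantifier prefix of a formula (`nil` and `pair`) and, for every node `u`, an
eigenvariable `eig u`. -/
inductive Obj (L : FirstOrder.Language.{0, 0}) : Type
  | nil : Obj L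
  | pair (u t : Obj L) : Obj L
  | eig (u : Obj L) : Obj L
  | func {n : ℕ} (f : L.Functions n) (ts : Fin n → Obj L) : Obj L

namespace Obj

variable {L : FirstOrder.Language.{0, 0}} {V : Type}

/-- The size of an object. -/
def size : Obj L → ℕ
  | nil => 0
  | pair u t => u.size + t.size + 1
  | eig u => u.size + 1
  | func _ ts => (∑ i, (ts i).size) + 1

/-- The value of a term in the Herbrand universe. -/
def eval (v : V → Obj L) : L.Term V → Obj L
  | .var x => v x
  | .func f ts => func f fun i => eval v (ts i)

/-- Truth values of the atoms of the Herbrand universe. -/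
abbrev Valuation (L : FirstOrder.Language.{0, 0}) : Type :=
  (Σ n, L.Relations n × (Fin n → Obj L)) → Bool

/-- The structure on the Herbrand universe given by a valuation of the atoms. -/
abbrev toStructure (ω : Valuation L) : L.Structure (Obj L) where
  funMap f ts := func f ts
  RelMap R ts := ω ⟨_, R, ts⟩ = true

theorem realize_toStructure (ω : Valuation L) (v : V → Obj L) (t : L.Term V) :
    @Term.realize L _ (toStructure ω) V v t = eval v t := by
  induction t with
  | var x => rfl
  | func f ts ih =>
    simp only [Term.realize, eval, ih]
    rfl

theorem apply_eval {M : Type} [L.Structure M] {e : Obj L → M}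
    (he : ∀ (n : ℕ) (f : L.Functions n) (ts : Fin n → Obj L),
      e (func f ts) = Structure.funMap f fun i => e (ts i)) (v : V → Obj L) (t : L.Term V) :
    e (eval v t) = t.realize fun x => e (v x) := by
  induction t with
  | var x => rfl
  | func f ts ih => simp only [eval, he, Term.realize, ih]

variable [DecidableEq V]

/-- Truth in the structure given by a valuation. -/
def Sat (ω : Valuation L) (A : Formula L V) (v : V → Obj L) : Prop :=
  @Formula.Holds L V _ (Obj L) (toStructure ω) A v

/-- Only finitely many coordinates of `ω` matter. -/
theorem isClopen_sat {A : Formula L V} (hA : A.IsQF) (v : V → Obj L) :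
    IsClopen {ω : Valuation L | Sat ω A v} := by
  induction A with
  | lit pos R ts =>
    have h : IsClopen {ω : Valuation L | ω ⟨_, R, fun i => eval v (ts i)⟩ = true} :=
      (isClopen_discrete ({true} : Set Bool)).preimage (continuous_apply _)
    cases pos with
    | true =>
      convert h using 3 with ω
      simp only [Sat, Formula.Holds, realize_toStructure]
      rfl
    | false =>
      convert h.compl using 1
      ext ω
      simp only [Sat, Formula.Holds, realize_toStructure]
      rfl
  | bin c A B ihA ihB =>
    cases c with
    | and => exact (ihA hA.1).inter (ihB hA.2)
    | or => exact (ihA hA.1).union (ihB hA.2)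
  | quant => exact hA.elim

/-- A universal quantifier is an intersection over all objects, which preserves closedness. -/
theorem isClosed_sat {A : Formula L V} (hA : A.IsUniversal) (v : V → Obj L) :
    IsClosed {ω : Valuation L | Sat ω A v} := by
  induction A generalizing v with
  | lit => exact (isClopen_sat (by simpa [Formula.IsUniversal] using hA) v).isClosed
  | bin => exact (isClopen_sat (by simpa [Formula.IsUniversal] using hA) v).isClosed
  | quant q x A ih =>
    cases q with
    | all =>
      have : {ω : Valuation L | Sat ω (.quant .all x A) v} =
          ⋂ m, {ω | Sat ω A (Function.update v x m)} := by
        ext ω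
        simp [Sat, Formula.Holds]
      rw [this]
      exact isClosed_iInter fun m => ih hA _
    | ex => simp [Formula.IsUniversal, Formula.IsQF] at hA

section Pullback

variable {M : Type} [L.Structure M] (e : Obj L → M)

/-- The truth values of the atoms under an interpretation of the Herbrand universe. -/
def pullback : Valuation L :=
  fun a => by classical exact decide (Structure.RelMap a.2.1 fun i => e (a.2.2 i))

variable {e} (he : ∀ (n : ℕ) (f : L.Functions n) (ts : Fin n → Obj L),
  e (func f ts) = Structure.funMap f fun i => e (ts i))

include he

theorem sat_pullback_iff {A : Formula L V} (hA : A.IsQF) (v : V → Obj L) :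
    Sat (pullback e) A v ↔ A.Holds fun x => e (v x) := by
  induction A with
  | lit pos R ts =>
    cases pos <;>
    · simp only [Sat, Formula.Holds, realize_toStructure, ← apply_eval he]
      simp [Structure.RelMap, pullback]
  | bin c A B ihA ihB =>
    have h₁ := ihA hA.1
    have h₂ := ihB hA.2
    simp only [Sat] at h₁ h₂
    cases c <;> simp [Sat, Formula.Holds, h₁, h₂]
  | quant => exact hA.elim

/-- In the pulled-back structure a universal quantifier only tests elements in the range of `e`, so
truth passes from `M` to the pullback. This is where the axioms have to be universal. -/
theorem sat_pullback_of_isUniversal {A : Formula L V} (hA : A.IsUniversal) (v : V → Obj L)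
    (h : A.Holds fun x => e (v x)) : Sat (pullback e) A v := by
  induction A generalizing v with
  | lit => exact (sat_pullback_iff he (by simpa [Formula.IsUniversal] using hA) v).2 h
  | bin => exact (sat_pullback_iff he (by simpa [Formula.IsUniversal] using hA) v).2 h
  | quant q x A ih =>
    cases q with
    | all =>
      intro m
      refine ih hA _ ?_
      convert h (e m) using 1
      funext y
      by_cases hy : y = x
      · subst hy; simp
      · simp [hy]
    | ex => simp [Formula.IsUniversal, Formula.IsQF] at hA

end Pullback

/-! ### The instantiation tree. -/

/-- The formula at a node of the instantiation tree of `A`, with the values of its variables. -/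
def node (A : Formula L V) : Obj L → Formula L V × (V → Obj L)
  | pair u t =>
    match (node A u).1 with
    | .quant _ x B => (B, Function.update (node A u).2 x t)
    | _ => node A u
  | _ => (A, fun _ => nil)

/-- The renaming of the variables at a node, given names for all nodes. -/
def nodeName (A : Formula L V) (ν : Obj L → V) : Obj L → V → V
  | pair u t =>
    match (node A u).1 with
    | .quant _ x _ => Function.update (nodeName A ν u) x (ν (pair u t))
    | _ => nodeName A ν u
  | _ => id

/-- The codes of nodes of the instantiation tree of `A`. -/
def IsNode (A : Formula L V) : Obj L → Prop
  | nil => True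
  | pair u t => IsNode A u ∧
    ((∃ x B, (node A u).1 = .quant .all x B ∧ t = eig u) ∨ ∃ x B, (node A u).1 = .quant .ex x B)
  | _ => False

theorem node_pair {A B : Formula L V} {u : Obj L} {q : Quantifier} {x : V}
    (h : (node A u).1 = .quant q x B) (t : Obj L) :
    node A (pair u t) = (B, Function.update (node A u).2 x t) := by
  rw [node, h]

theorem nodeName_pair {A B : Formula L V} {u : Obj L} {q : Quantifier} {x : V}
    (h : (node A u).1 = .quant q x B) (ν : Obj L → V) (t : Obj L) :
    nodeName A ν (pair u t) = Function.update (nodeName A ν u) x (ν (pair u t)) := by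
  rw [nodeName, h]

theorem IsNode.isPrenex {A : Formula L V} (hA : A.IsPrenex) {u : Obj L} (hu : IsNode A u) :
    (node A u).1.IsPrenex := by
  induction u with
  | nil => exact hA
  | pair u t ih _ =>
    have := ih hu.1
    rcases hu.2 with ⟨x, B, h, -⟩ | ⟨x, B, h⟩ <;>
    · rw [h] at this
      rw [node_pair h]
      exact this
  | eig => exact hu.elim
  | func => exact hu.elim

/-- Follow a true branch: a universal formula is true at `eig u` in particular, and an existential
one at some object. -/
theorem exists_isNode_sat {ω : Valuation L} {A : Formula L V} (C : Formula L V)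
    (hC : C.IsPrenex) {u : Obj L} (hu : IsNode A u) (hCu : (node A u).1 = C)
    (h : Sat ω C (node A u).2) :
    ∃ w, IsNode A w ∧ (node A w).1.IsQF ∧ Sat ω (node A w).1 (node A w).2 := by
  induction C generalizing u with
  | lit => exact ⟨u, hu, by rw [hCu]; exact hC, by rw [hCu]; exact h⟩
  | bin => exact ⟨u, hu, by rw [hCu]; exact hC, by rw [hCu]; exact h⟩
  | quant q x B ih =>
    cases q with
    | all =>
      refine ih hC (u := pair u (eig u)) ⟨hu, Or.inl ⟨x, B, hCu, rfl⟩⟩ (by rw [node_pair hCu]) ?_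
      rw [node_pair hCu]
      exact h (eig u)
    | ex =>
      obtain ⟨t, ht⟩ := h
      refine ih hC (u := pair u t) ⟨hu, Or.inr ⟨x, B, hCu⟩⟩ (by rw [node_pair hCu]) ?_
      rw [node_pair hCu]
      exact ht

/-- The valuations satisfying `T` form a closed subset of a product of copies of `Bool`. By validity
the clopen sets of the leaves cover it, so a finite subcover exists. -/
theorem exists_finset_isNode {T : Set (Formula L V)} (hT : ∀ B ∈ T, B.IsUniversal)
    {A : Formula L V} (hA : A.IsPrenex) (hvalid : Valid T A) :
    ∃ P : Finset (Obj L), (∀ u ∈ P, IsNode A u ∧ (node A u).1.IsQF) ∧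
      ∀ ω : Valuation L, (∀ B ∈ T, ∀ v : V → Obj L, Sat ω B v) →
        ∃ u ∈ P, Sat ω (node A u).1 (node A u).2 := by
  have hK : IsCompact {ω : Valuation L | ∀ B ∈ T, ∀ v : V → Obj L, Sat ω B v} := by
    refine IsClosed.isCompact ?_
    simp only [Set.ofPred_forall]
    exact isClosed_iInter fun B => isClosed_iInter fun hB => isClosed_iInter fun v =>
      isClosed_sat (hT B hB) v
  obtain ⟨P, hP⟩ := hK.elim_finite_subcover
    (fun u : {u : Obj L // IsNode A u ∧ (node A u).1.IsQF} =>
      {ω : Valuation L | Sat ω (node A u.1).1 (node A u.1).2})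
    (fun u => (isClopen_sat u.2.2 _).isOpen) (by
      intro ω hω
      have : Nonempty (Obj L) := ⟨nil⟩
      obtain ⟨w, h₁, h₂, h₃⟩ := exists_isNode_sat (ω := ω) (A := A) (u := nil) A hA trivial rfl
        (@hvalid (Obj L) _ (toStructure ω) hω _)
      exact Set.mem_iUnion.2 ⟨⟨w, h₁, h₂⟩, h₃⟩)
  classical
  refine ⟨P.image Subtype.val, ?_, fun ω hω => ?_⟩
  · intro u hu
    obtain ⟨w, -, rfl⟩ := Finset.mem_image.1 hu
    exact w.2
  · obtain ⟨w, hw, h⟩ := Set.mem_iUnion₂.1 (hP hω)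
    exact ⟨w.1, Finset.mem_image_of_mem _ hw, h⟩

/-! ### Reading objects as terms. -/

section Terms

variable (c : L.Constants) (ν : Obj L → V) (E : Set (Obj L))

/-- The term denoted by an object: for `u ∈ E`, the eigenvariable of `u` is the variable that names
the child of `u`; everything else that is not a term is replaced by `c`. -/
def toTerm : Obj L → L.Term V
  | nil => c.term
  | pair _ _ => c.term
  | eig u => by classical exact if u ∈ E then .var (ν (pair u (eig u))) else c.term
  | func f ts => .func f fun i => toTerm (ts i)

/-- A variable of the term stems from some `eig u` inside `t`. The strict size bound is what makes
an ordering of the nodes by size respect the variable condition. -/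
theorem exists_of_mem_varFinset_toTerm {t : Obj L} {x : V} (hx : x ∈ (toTerm c ν E t).varFinset) :
    ∃ u ∈ E, x = ν (pair u (eig u)) ∧ u.size < t.size := by
  induction t with
  | nil => simp [toTerm, Constants.term] at hx
  | pair => simp [toTerm, Constants.term] at hx
  | eig u =>
    simp only [toTerm] at hx
    split_ifs at hx with hu
    · exact ⟨u, hu, by simpa using hx, by simp [size]⟩
    · simp [Constants.term] at hx
  | func f ts ih =>
    simp only [toTerm, Term.varFinset, Finset.mem_biUnion, Finset.mem_univ, true_and] at hx
    obtain ⟨i, hi⟩ := hx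
    obtain ⟨u, hu, rfl, hlt⟩ := ih i hi
    refine ⟨u, hu, rfl, ?_⟩
    have : (ts i).size ≤ ∑ j, (ts j).size :=
      Finset.single_le_sum (f := fun j => (ts j).size) (fun _ _ => Nat.zero_le _)
        (Finset.mem_univ i)
    simp only [size]
    omega

/-- The instance at a node. -/
def toInstance (A : Formula L V) (u : Obj L) : Instance L V :=
  ⟨(node A u).1, nodeName A ν u, fun x => toTerm c ν E ((node A u).2 x)⟩

variable {c ν E}

theorem toInstance_pair {A B : Formula L V} {u : Obj L} {q : Quantifier} {x : V}
    (h : (node A u).1 = .quant q x B) (t : Obj L) :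
    toInstance c ν E A (pair u t) = ⟨B, Function.update (nodeName A ν u) x (ν (pair u t)),
      Function.update (fun x => toTerm c ν E ((node A u).2 x)) x (toTerm c ν E t)⟩ := by
  simp only [toInstance, nodeName_pair h, node_pair h]
  congr 1
  funext y
  by_cases hy : y = x
  · subst hy; simp
  · simp [hy]

end Terms

/-! ### Scheduling the nodes. -/

/-- The nodes above a given node. -/
def ancestors [DecidableEq (Obj L)] : Obj L → Finset (Obj L)
  | pair u t => insert (pair u t) (ancestors u)
  | u => {u}

theorem self_mem_ancestors [DecidableEq (Obj L)] (u : Obj L) : u ∈ ancestors u := by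
  cases u <;> simp [ancestors]

theorem mem_ancestors_of_pair [DecidableEq (Obj L)] {u t w : Obj L}
    (h : pair u t ∈ ancestors w) : u ∈ ancestors w := by
  induction w with
  | pair u' t' ih _ =>
    rw [ancestors, Finset.mem_insert] at h ⊢
    rcases h with h | h
    · obtain ⟨rfl, rfl⟩ := Obj.pair.inj h
      exact Or.inr (self_mem_ancestors u)
    · exact Or.inr (ih h)
  | _ => simp [ancestors] at h

theorem IsNode.of_mem_ancestors [DecidableEq (Obj L)] {A : Formula L V} {u w : Obj L}
    (hw : IsNode A w) (h : u ∈ ancestors w) : IsNode A u := by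
  induction w with
  | pair u' t' ih _ =>
    rw [ancestors, Finset.mem_insert] at h
    rcases h with rfl | h
    · exact hw
    · exact ih hw.1 h
  | _ =>
    simp only [ancestors, Finset.mem_singleton] at h
    exact h ▸ hw

/-- The nodes with a universal formula whose child belongs to `N`. -/
def eigenNodes (A : Formula L V) (N : Finset (Obj L)) : Set (Obj L) :=
  {u | pair u (eig u) ∈ N ∧ ∃ x B, (node A u).1 = .quant .all x B}

/-- The eigenvariables introduced at the members of `N`. -/
def universals (A : Formula L V) (ν : Obj L → V) (N : Finset (Obj L)) : Finset V := by
  classical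
  exact (N.filter fun w => ∃ u x B, w = pair u (eig u) ∧ (node A u).1 = .quant .all x B).image ν

theorem mem_universals {A : Formula L V} {ν : Obj L → V} {N : Finset (Obj L)} {u : Obj L} {x : V}
    {B : Formula L V} (hu : pair u (eig u) ∈ N) (h : (node A u).1 = .quant .all x B) :
    ν (pair u (eig u)) ∈ universals A ν N := by
  classical
  exact Finset.mem_image_of_mem ν (Finset.mem_filter.2 ⟨hu, u, x, B, rfl, h⟩)

variable [Infinite V]

/-- `N'` consists of the nodes introduced so far, `S` of those still in the sequent. A universal
node is replaced by its child, while an existential one survives by contraction, so only nodes as in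
`hNS` leave `S`. Universal inferences are made whenever one is possible; otherwise a smallest
remaining node is introduced. Its parent is then existential, and the eigenvariables in its term are
already available. -/
theorem derivable_map_toInstance [DecidableEq (Obj L)] {T : Set (Formula L V)} {A : Formula L V}
    (hA : A.IsPrenex) (c : L.Constants) (ν : Obj L → V) (N P : Finset (Obj L))
    (hN : ∀ u ∈ N, IsNode A u) (hcl : ∀ u t, pair u t ∈ N → u ∈ N) (hν : Set.InjOn ν N)
    (hPN : P ⊆ N) (hP : ∀ u ∈ P, (node A u).1.IsQF)
    (hT : ∀ (M : Type) [Nonempty M] [L.Structure M], (∀ B ∈ T, ∀ v : V → M, B.Holds v) →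
      ∀ v : V → M, ∃ u ∈ P, (toInstance c ν (eigenNodes A N) A u).Holds v)
    (N' S : Finset (Obj L)) (hN' : N' ⊆ N) (hnil : nil ∈ N') (hS : S ⊆ N')
    (hNS : ∀ u ∈ N', u ∉ S → ∃ x B, (node A u).1 = .quant .all x B ∧ pair u (eig u) ∈ N') :
    Derivable T (universals A ν N') (N'.image ν)
      (S.val.map (toInstance c ν (eigenNodes A N) A)) := by
  induction hn : (N \ N').card generalizing N' S with
  | zero =>
    obtain rfl : N' = N := hN'.antisymm (Finset.sdiff_eq_empty_iff_subset.1
      (Finset.card_eq_zero.1 hn))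
    refine derivable_of_isPrenex c T _ _ _ ?_ fun M _ _ hM v => ?_
    · intro g hg
      obtain ⟨u, hu, rfl⟩ := Multiset.mem_map.1 hg
      exact (hN u (hS hu)).isPrenex hA
    · obtain ⟨u, hu, h⟩ := hT M hM v
      refine ⟨_, Multiset.mem_map_of_mem _ ?_, hP u hu, h⟩
      -- The leaves in `P` are never lost: a node outside `S` is universal, hence not
      -- quantifier-free.
      by_contra hcon
      obtain ⟨x, B, he, -⟩ := hNS u (hPN hu) hcon
      have := hP u hu
      rw [he] at this
      exact this
  | succ n ih =>
    have hcard : ∀ w ∈ N, w ∉ N' → (N \ insert w N').card = n := by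
      intro w hw hw'
      rw [Finset.sdiff_insert, Finset.card_erase_of_mem (Finset.mem_sdiff.2 ⟨hw, hw'⟩), hn]
      rfl
    have hνw : ∀ w ∈ N, w ∉ N' → ν w ∉ N'.image ν := by
      intro w hw hw' h
      obtain ⟨u, hu, he⟩ := Finset.mem_image.1 h
      exact hw' (hν (hN' hu) hw he ▸ hu)
    by_cases hall : ∃ u ∈ N', ∃ x B, (node A u).1 = .quant .all x B ∧
        pair u (eig u) ∈ N ∧ pair u (eig u) ∉ N'
    · obtain ⟨u, hu, x, B, he, hw, hw'⟩ := hall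
      have huS : u ∈ S := by
        by_contra hcon
        obtain ⟨-, -, -, h⟩ := hNS u hu hcon
        exact hw' h
      have hne : pair u (eig u) ∉ S.erase u := fun h => hw' (hS (Finset.mem_of_mem_erase h))
      have key := ih (insert (pair u (eig u)) N') (insert (pair u (eig u)) (S.erase u))
        (Finset.insert_subset hw hN') (Finset.mem_insert_of_mem hnil)
        (Finset.insert_subset_insert _ ((Finset.erase_subset _ _).trans hS)) ?_ (hcard _ hw hw')
      · rw [← Finset.insert_erase huS, Finset.insert_val_of_notMem (Finset.notMem_erase u S),
          Multiset.map_cons]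
        rw [Finset.insert_val_of_notMem hne, Multiset.map_cons, toInstance_pair he,
          Finset.image_insert] at key
        have hU : universals A ν (insert (pair u (eig u)) N') =
            insert (ν (pair u (eig u))) (universals A ν N') := by
          rw [universals, Finset.filter_insert, if_pos ⟨u, x, B, rfl, he⟩, Finset.image_insert]
          rfl
        have ht : toTerm c ν (eigenNodes A N) (eig u) = .var (ν (pair u (eig u))) := by
          simp only [toTerm]
          exact if_pos ⟨hw, x, B, he⟩
        rw [hU, ht] at key
        rw [toInstance, he]
        exact .all _ _ _ _ _ _ _ _ (hνw _ hw hw') key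
      · intro w hwN hwS
        rw [Finset.mem_insert, Finset.mem_erase] at hwS
        push Not at hwS
        by_cases hwu : w = u
        · subst hwu
          exact ⟨x, B, he, Finset.mem_insert_self _ _⟩
        · obtain ⟨y, C, h₁, h₂⟩ := hNS w ((Finset.mem_insert.1 hwN).resolve_left hwS.1)
            (hwS.2 hwu)
          exact ⟨y, C, h₁, Finset.mem_insert_of_mem h₂⟩
    · push Not at hall
      obtain ⟨w, hw, hmin⟩ := Finset.exists_min_image (N \ N') size
        (Finset.card_pos.1 (by omega))
      obtain ⟨hwN, hwN'⟩ := Finset.mem_sdiff.1 hw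
      have hsmall : ∀ u ∈ N, u.size < w.size → u ∈ N' := by
        intro u hu hlt
        by_contra hcon
        have := hmin u (Finset.mem_sdiff.2 ⟨hu, hcon⟩)
        omega
      have hnode := hN w hwN
      cases w with
      | nil => exact (hwN' hnil).elim
      | eig => exact hnode.elim
      | func => exact hnode.elim
      | pair u t =>
        have hu : u ∈ N' := hsmall u (hcl u t hwN) (by simp only [size]; omega)
        rcases hnode.2 with ⟨x, B, he, rfl⟩ | ⟨x, B, he⟩
        · exact (hwN' (hall u hu x B he hwN)).elim
        · have huS : u ∈ S := by
            by_contra hcon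
            obtain ⟨y, C, h, -⟩ := hNS u hu hcon
            rw [he] at h
            cases h
          have hne : pair u t ∉ S := fun h => hwN' (hS h)
          have key := ih (insert (pair u t) N') (insert (pair u t) S)
            (Finset.insert_subset hwN hN') (Finset.mem_insert_of_mem hnil)
            (Finset.insert_subset_insert _ hS) ?_ (hcard _ hwN hwN')
          · have hU : universals A ν (insert (pair u t) N') = universals A ν N' := by
              rw [universals, Finset.filter_insert, if_neg]
              · rfl
              · rintro ⟨u', y, C, h₁, h₂⟩
                obtain ⟨rfl, rfl⟩ := Obj.pair.inj h₁
                rw [he] at h₂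
                cases h₂
            rw [Finset.insert_val_of_notMem hne, Multiset.map_cons, toInstance_pair he,
              Finset.image_insert, hU] at key
            rw [← Finset.insert_erase huS,
              Finset.insert_val_of_notMem (Finset.notMem_erase u S), Multiset.map_cons] at key ⊢
            have hi : toInstance c ν (eigenNodes A N) A u = ⟨.quant .ex x B, nodeName A ν u,
                fun x => toTerm c ν (eigenNodes A N) ((node A u).2 x)⟩ := by
              rw [toInstance, he]
            rw [hi] at key ⊢
            refine .contr _ _ _ _ _ _ _ (.ex _ _ _ _ _ _ _ _ (hνw _ hwN hwN') _ ?_ key)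
            intro y hy
            obtain ⟨u', hu', rfl, hlt⟩ := exists_of_mem_varFinset_toTerm c ν _ hy
            obtain ⟨hu'N, z, C, he'⟩ := hu'
            -- The child of `u'` need not be smaller than the chosen node. Minimality is therefore
            -- applied to `u'`, and `hall`, the absence of pending universal inferences, supplies
            -- the child.
            have hu'N' : u' ∈ N' := hsmall u' (hcl _ _ hu'N) (by simp only [size]; omega)
            exact mem_universals (hall u' hu'N' z C he' hu'N) he'
          · intro w hwN hwS
            rw [Finset.mem_insert] at hwS
            push Not at hwS
            obtain ⟨y, C, h₁, h₂⟩ := hNS w ((Finset.mem_insert.1 hwN).resolve_left hwS.1) hwS.2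
            exact ⟨y, C, h₁, Finset.mem_insert_of_mem h₂⟩

end Obj

/-! ### Herbrand's theorem and the equivalence. -/

/-- Herbrand's theorem: a valid closed prenex formula has a linear derivation. -/
theorem Valid.exists_derivable {L : FirstOrder.Language.{0, 0}} {V : Type} [DecidableEq V]
    [Infinite V] (c : L.Constants) {T : Set (Formula L V)} (hT : ∀ B ∈ T, B.IsUniversal)
    {A : Formula L V} (hA : A.IsPrenex) (hvalid : Valid T A) :
    ∃ (Y : Finset V) (σ : V → L.Term V), Derivable T ∅ Y {⟨A, id, σ⟩} := by
  classical
  obtain ⟨P, hP, hsat⟩ := Obj.exists_finset_isNode hT hA hvalid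
  set N : Finset (Obj L) := insert .nil (P.biUnion Obj.ancestors) with hN
  obtain ⟨f⟩ : Nonempty (N ↪ V) := by
    obtain ⟨s, hs⟩ := Infinite.exists_subset_card_eq V N.card
    exact ⟨(Finset.equivOfCardEq hs.symm).toEmbedding.trans (Function.Embedding.subtype _)⟩
  -- Off `N` the name is a default value; names need to be distinct only on `N`.
  let ν : Obj L → V := fun u => if h : u ∈ N then f ⟨u, h⟩ else f ⟨.nil, Finset.mem_insert_self _ _⟩
  have hν : Set.InjOn ν N := by
    intro u hu w hw h
    have hu' : u ∈ N := hu
    have hw' : w ∈ N := hw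
    simp only [ν, hu', hw', dif_pos] at h
    exact congrArg Subtype.val (f.injective h)
  have key := Obj.derivable_map_toInstance (T := T) hA c ν N P ?_ ?_ hν ?_ (fun u hu => (hP u hu).2)
    ?_ {.nil} {.nil} (Finset.singleton_subset_iff.2 (Finset.mem_insert_self _ _))
    (Finset.mem_singleton_self _) subset_rfl fun u hu h => (h hu).elim
  · have hU : Obj.universals A ν {.nil} = ∅ := by
      rw [Obj.universals, Finset.filter_singleton, if_neg, Finset.image_empty]
      rintro ⟨u, x, B, h, -⟩
      cases h
    rw [hU] at key
    exact ⟨_, _, key⟩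
  · intro u hu
    rcases Finset.mem_insert.1 hu with rfl | hu
    · trivial
    · obtain ⟨w, hw, h⟩ := Finset.mem_biUnion.1 hu
      exact (hP w hw).1.of_mem_ancestors h
  · intro u t hu
    rcases Finset.mem_insert.1 hu with h | hu
    · cases h
    · obtain ⟨w, hw, h⟩ := Finset.mem_biUnion.1 hu
      exact Finset.mem_insert_of_mem (Finset.mem_biUnion.2 ⟨w, hw, Obj.mem_ancestors_of_pair h⟩)
  · exact fun u hu => Finset.mem_insert_of_mem
      (Finset.mem_biUnion.2 ⟨u, hu, Obj.self_mem_ancestors u⟩)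
  · intro M _ _ hM v
    -- An arbitrary model of `T` with an assignment is reduced to a valuation: evaluating the term
    -- of each object respects function symbols, so the finite set of leaves that serves all
    -- valuations also serves `M`.
    let e : Obj L → M := fun u => (Obj.toTerm c ν (Obj.eigenNodes A N) u).realize v
    have he : ∀ (n : ℕ) (f : L.Functions n) (ts : Fin n → Obj L),
        e (.func f ts) = Structure.funMap f fun i => e (ts i) := fun _ _ _ => rfl
    obtain ⟨u, hu, h⟩ := hsat (Obj.pullback e) fun B hB w =>
      Obj.sat_pullback_of_isUniversal he (hT B hB) w (hM B hB _)
    exact ⟨u, hu, (Obj.sat_pullback_iff he (hP u hu).2 _).1 h⟩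

end

end Herbrand

theorem mainTheorem5
    (L : FirstOrder.Language.{0, 0}) (V I : Type)
    [DecidableEq V] [Infinite V] [DecidableEq I] [Nonempty I]
    (hconst : Nonempty L.Constants)
    (T : Set (Herbrand.Formula L V)) (hTfin : T.Finite) (hTuniv : ∀ B ∈ T, B.IsUniversal)
    (A : Herbrand.Formula L V) (hprenex : A.IsPrenex) (hclosed : A.IsClosed) :
    (∃ t : Herbrand.ExpTree L V I, Herbrand.LKProvable T {Herbrand.Root.typed t A}) ↔
      Nonempty (Herbrand.HerbrandProof T A) := by
  obtain ⟨c⟩ := hconst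
  refine ⟨fun ⟨t, h⟩ => ?_, fun ⟨h⟩ => ?_⟩
  · obtain ⟨Y, σ, hd⟩ := h.valid.exists_derivable c hTuniv hprenex
    exact hd.nonempty_herbrandProof hclosed
  · obtain ⟨Y, σ, hd⟩ := h.valid.exists_derivable c hTuniv hprenex
    exact hd.lkProvable hprenex hclosed
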